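/- Let $\mathbb K$ be $\mathbb R$ or $\mathbb C$, let $G$ be a locally compact Hausdorff group with left Haar measure $ds$ and modular function $\Delta$ (normalized by $\Delta(r)\int_G f(sr)\,ds=\int_G f(s)\,ds$), and let $\mathcal H$ be a non-empty class of Hilbert spaces over $\mathbb K$. Let $\mathcal R$ be the class of all unitary strongly continuous representations of $G$ in the spaces from $\mathcal H$. Equip $C_c(G)=C_c(G,\mathbb K)$ with the convolution $(f*g)(s)=\int_G f(r)g(r^{-1}s)\,dr$ and the involution $f^*(s)=\Delta(s^{-1})\overline{f(s^{-1})}$. For $U\in\mathcal R$ on $X_U$ let $U(f)=\int_G f(s)U_s\,ds\in B(X_U)$, and put $$\sigma^{\mathcal R}(f)=\sup_{U\in\mathcal R}\|U(f)\|\qquad(f\in C_c(G)).$$ Let $(\mathbb K\rtimes_{\mathrm{triv}}G)^{\mathcal R}$ be the $C^*$-algebra obtained by completing $C_c(G)/\ker\sigma^{\mathcal R}$ in the norm induced by $\sigma^{\mathcal R}$ (a real $*$-algebra with a complete norm satisfying the $C^*$-identity if $\mathbb K=\mathbb R$), let $q^{\mathcal R}:C_c(G)\to(\mathbb K\rtimes_{\mathrm{triv}}G)^{\mathcal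 R}$ be the canonical map, and for $U\in\mathcal R$ let $U^{\mathcal R}$ be the involutive representation of $(\mathbb K\rtimes_{\mathrm{triv}}G)^{\mathcal R}$ on $X_U$ determined by continuity and $U^{\mathcal R}(q^{\mathcal R}(f))=U(f)$ for $f\in C_c(G)$. Then $U\mapsto U^{\mathcal R}$ is a bijection from $\mathcal R$ onto the class of all non-degenerate involutive representations of $(\mathbb K\rtimes_{\mathrm{triv}}G)^{\mathcal R}$ in the spaces from $\mathcal H$ (a representation $T$ on $X$ is non-degenerate if the linear span of all vectors $T(a)x$ is dense in $X$). For $U,V\in\mathcal R$, the closed subspaces of $X_U$ invariant under $U$ are exactly those invariant under $U^{\mathcal R}$, and the bounded operators $\Phi:X_U\to X_V$ that intertwine $U$ and $V$ are exactly those that intertwine $U^{\mathcal R}$ and $V^{\mathcal R}$, so that the two Banach spaces of intertwining operators coincide. Moreover, if $\mathcal H$ consists of all Hilbert spaces, then $(\mathbb K\rtimes_{\mathrm{triv}}G)^{\mathcal R}$ is the group $C^*$-algebra $C^*(G)$: for every $f\in C_c(G)$, $\|q^{\mathcal R}(f)\|$ is the supremum of $\|\pi(f)\|$ over all non-degenerate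 involutive representations $\pi$ of $C_c(G)$ in Hilbert spaces with $\|\pi(g)\|\le\|g\|_{L^1(G)}$ for all $g\in C_c(G)$. -/

import Mathlib

universe w u v

namespace GroupCrossed

open MeasureTheory Measure Set Topology
open scoped CompactlySupported Pointwise

section Modular

variable {G : Type*} [Group G] [TopologicalSpace G] [IsTopologicalGroup G]
  [LocallyCompactSpace G]

/-- The modular function `Δ`, normalised by `Δ r * ∫ f (s * r) ds = ∫ f s ds` for the left Haar
integral. Mathlib's `modularCharacter` is normalised by `∫ f (s * r) ds = Δ r * ∫ f s ds`. -/
noncomputable def modularFunction (r : G) : ℝ := ((modularCharacter r : NNReal) : ℝ)⁻¹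

theorem modularFunction_pos (r : G) : 0 < modularFunction r :=
  inv_pos.2 (NNReal.coe_pos.2 (modularCharacterFun_pos r))

theorem modularFunction_one : modularFunction (1 : G) = 1 := by
  simp [modularFunction]

theorem modularFunction_mul (r s : G) :
    modularFunction (r * s) = modularFunction r * modularFunction s := by
  simp [modularFunction, mul_comm]

theorem modularFunction_inv (r : G) : modularFunction r⁻¹ = (modularFunction r)⁻¹ := by
  refine eq_inv_of_mul_eq_one_left ?_
  rw [← modularFunction_mul, inv_mul_cancel, modularFunction_one]

variable [MeasurableSpace G] [BorelSpace G] (μ : Measure G) [μ.IsHaarMeasure]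

theorem modularFunction_mul_integral (r : G) {f : G → ℝ} (hf : Continuous f)
    (hc : HasCompactSupport f) :
    modularFunction r * ∫ s, f (s * r) ∂μ = ∫ s, f s ∂μ := by
  have h := integral_isMulLeftInvariant_eq_smul_of_hasCompactSupport (map (· * r) μ) μ hf hc
  rw [← modularCharacterFun_eq_haarScalarFactor, integral_smul_nnreal_measure,
    integral_map (by fun_prop) hf.aestronglyMeasurable] at h
  rw [h]
  change (((modularCharacterFun r : NNReal) : ℝ))⁻¹ * (((modularCharacterFun r : NNReal) : ℝ) * _) = _
  rw [inv_mul_cancel_left₀]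
  exact (NNReal.coe_pos.2 (modularCharacterFun_pos r)).ne'

theorem exists_bump : ∃ g : G → ℝ, Continuous g ∧ HasCompactSupport g ∧ 0 < ∫ s, g s ∂μ := by
  obtain ⟨⟨f, f_cont⟩, f_comp, f_nonneg, f_one⟩ :
    ∃ f : C(G, ℝ), HasCompactSupport f ∧ 0 ≤ f ∧ f 1 ≠ 0 := exists_continuous_nonneg_pos 1
  exact ⟨f, f_cont, f_comp,
    f_cont.integral_pos_of_hasCompactSupport_nonneg_nonzero f_comp f_nonneg f_one⟩

theorem continuous_modularFunction : Continuous (modularFunction : G → ℝ) := by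
  borelize G
  let ν : Measure G := haar
  obtain ⟨g, hg, hc, hpos⟩ := exists_bump ν
  have key : ∀ r : G, modularFunction r⁻¹ = (∫ s, g (s * r) ∂ν) / ∫ s, g s ∂ν := by
    intro r
    rw [← modularFunction_mul_integral ν r hg hc, modularFunction_inv]
    have h1 := modularFunction_mul_integral ν r hg hc
    have h2 : (∫ s, g (s * r) ∂ν) ≠ 0 := by
      intro h; rw [h, mul_zero] at h1; exact hpos.ne h1
    have h3 := (modularFunction_pos r).ne'
    field_simp
  have hcont : Continuous fun r : G => ∫ s, g (s * r) ∂ν := by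
    apply continuous_iff_continuousAt.2 (fun x₀ ↦ ?_)
    obtain ⟨t, t_comp, ht⟩ : ∃ t, IsCompact t ∧ t ∈ 𝓝 x₀ := exists_compact_mem_nhds x₀
    have A : ContinuousOn (fun r : G ↦ ∫ s, g (s * r) ∂ν) t := by
      apply continuousOn_integral_of_compact_support
        (k := (fun p : G × G => p.1 * p.2⁻¹) '' (tsupport g ×ˢ t))
      · exact (hc.isCompact.prod t_comp).image (by fun_prop)
      · exact (hg.comp (continuous_snd.mul continuous_fst)).continuousOn
      · intro p x hp hx
        contrapose! hx
        exact ⟨(x * p, p), ⟨subset_tsupport _ hx, hp⟩, by simp⟩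
    exact A.continuousAt ht
  have h : Continuous fun r : G => modularFunction r⁻¹ := by
    simp_rw [key]; exact hcont.div_const _
  have h' := h.comp continuous_inv
  simpa only [Function.comp_def, inv_inv] using h'

theorem swap_integral {E : Type*} [NormedAddCommGroup E] [NormedSpace ℝ E] {F : G → G → E}
    {K L : Set G} (hK : IsCompact K) (hL : IsCompact L) (hF : Continuous fun p : G × G => F p.1 p.2)
    (h : ∀ x y, F x y ≠ 0 → x ∈ K ∧ y ∈ L) :
    ∫ x, ∫ y, F x y ∂μ ∂μ = ∫ y, ∫ x, F x y ∂μ ∂μ := by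
  apply integral_integral_swap_of_hasCompactSupport hF
  refine HasCompactSupport.intro (hK.prod hL) ?_
  rintro ⟨x, y⟩ hxy
  by_contra hne
  exact hxy (h x y hne)

theorem integral_modularFunction_inv {E : Type*} [NormedAddCommGroup E] [NormedSpace ℝ E]
    [CompleteSpace E]
    {f : G → E} (hf : Continuous f) (hc : HasCompactSupport f) :
    ∫ s, modularFunction s⁻¹ • f s⁻¹ ∂μ = ∫ s, f s ∂μ := by
  obtain ⟨g, hg, hgc, hpos⟩ := exists_bump μ
  have h1 : ∫ s, ∫ t, g s • f (s⁻¹ * t) ∂μ ∂μ = (∫ s, g s ∂μ) • ∫ t, f t ∂μ := by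
    have h0 : ∀ s : G, ∫ t, f (s⁻¹ * t) ∂μ = ∫ t, f t ∂μ := fun s =>
      integral_mul_left_eq_self f s⁻¹
    simp_rw [integral_smul, h0, integral_smul_const]
  have h2 : ∫ s, ∫ t, g s • f (s⁻¹ * t) ∂μ ∂μ = ∫ t, ∫ s, g s • f (s⁻¹ * t) ∂μ ∂μ := by
    apply swap_integral μ (K := tsupport g) (L := tsupport g * tsupport f) hgc.isCompact
      (hgc.isCompact.mul hc.isCompact)
    · fun_prop
    · intro s t h
      have a := subset_tsupport g (left_ne_zero_of_smul h)
      have b := subset_tsupport f (right_ne_zero_of_smul h)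
      exact ⟨a, ⟨s, a, _, b, by simp⟩⟩
  have h3 : ∀ t, ∫ s, g s • f (s⁻¹ * t) ∂μ = ∫ s, g (t * s) • f s⁻¹ ∂μ := by
    intro t
    rw [← integral_mul_left_eq_self (μ := μ) _ t]
    simp
  have h4 : ∫ t, ∫ s, g (t * s) • f s⁻¹ ∂μ ∂μ = ∫ s, ∫ t, g (t * s) • f s⁻¹ ∂μ ∂μ := by
    apply swap_integral μ (K := tsupport g * tsupport f) (L := (tsupport f)⁻¹)
      (hgc.isCompact.mul hc.isCompact) hc.isCompact.inv
    · fun_prop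
    · intro t s h
      have a := subset_tsupport g (left_ne_zero_of_smul h)
      have b := subset_tsupport f (right_ne_zero_of_smul h)
      exact ⟨⟨_, a, _, b, by simp⟩, by simpa using b⟩
  have h5 : ∀ s, ∫ t, g (t * s) • f s⁻¹ ∂μ = (∫ t, g t ∂μ) • (modularFunction s⁻¹ • f s⁻¹) := by
    intro s
    rw [integral_smul_const, ← modularFunction_mul_integral μ s hg hgc, smul_smul,
      modularFunction_inv, mul_right_comm, mul_inv_cancel₀ (modularFunction_pos s).ne', one_mul]
  rw [h2] at h1
  simp_rw [h3] at h1
  rw [h4] at h1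
  simp_rw [h5] at h1
  rw [integral_smul] at h1
  exact smul_right_injective _ hpos.ne' h1

end Modular

/-- The space `C_c(G)` of compactly supported continuous `𝕜`-valued functions on `G`. It is a type
synonym that carries the convolution product and involution with respect to the left Haar
measure `μ`, instead of the pointwise ones. -/
def ConvAlg (𝕜 : Type*) [RCLike 𝕜] (G : Type*) [TopologicalSpace G] [MeasurableSpace G]
    (_μ : Measure G) : Type _ := C_c(G, 𝕜)

namespace ConvAlg

section Linear

variable {𝕜 : Type*} [RCLike 𝕜] {G : Type*} [TopologicalSpace G] [MeasurableSpace G]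
  {μ : Measure G}

instance : FunLike (ConvAlg 𝕜 G μ) G 𝕜 := inferInstanceAs (FunLike C_c(G, 𝕜) G 𝕜)

noncomputable instance : AddCommGroup (ConvAlg 𝕜 G μ) := inferInstanceAs (AddCommGroup C_c(G, 𝕜))

noncomputable instance : Module 𝕜 (ConvAlg 𝕜 G μ) := inferInstanceAs (Module 𝕜 C_c(G, 𝕜))

@[ext] theorem ext {f g : ConvAlg 𝕜 G μ} (h : ∀ s, f s = g s) : f = g := DFunLike.ext _ _ h

@[simp] theorem add_apply (f g : ConvAlg 𝕜 G μ) (s : G) : (f + g) s = f s + g s := rfl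

@[simp] theorem zero_apply (s : G) : (0 : ConvAlg 𝕜 G μ) s = 0 := rfl

@[simp] theorem smul_apply (c : 𝕜) (f : ConvAlg 𝕜 G μ) (s : G) : (c • f) s = c * f s := rfl

@[fun_prop] theorem continuous (f : ConvAlg 𝕜 G μ) : Continuous f :=
  ContinuousMap.continuous (CompactlySupportedContinuousMap.toContinuousMap f)

theorem hasCompactSupport (f : ConvAlg 𝕜 G μ) : HasCompactSupport f :=
  CompactlySupportedContinuousMap.hasCompactSupport' f

/-- The element of `C_c(G)` given by a continuous function with compact support. -/
def mk (f : G → 𝕜) (hf : Continuous f) (hc : HasCompactSupport f) : ConvAlg 𝕜 G μ :=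
  (⟨⟨f, hf⟩, hc⟩ : C_c(G, 𝕜))

@[simp] theorem mk_apply (f : G → 𝕜) (hf : Continuous f) (hc : HasCompactSupport f) (s : G) :
    (mk f hf hc : ConvAlg 𝕜 G μ) s = f s := rfl

/-- The `L¹`-norm `∫ ‖f s‖ ds`. -/
noncomputable def l1norm (f : ConvAlg 𝕜 G μ) : ℝ := ∫ s, ‖f s‖ ∂μ

end Linear

section Algebra

variable {𝕜 : Type*} [RCLike 𝕜] {G : Type*} [Group G] [TopologicalSpace G] [IsTopologicalGroup G]
  [LocallyCompactSpace G] [MeasurableSpace G] [BorelSpace G]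
  {μ : Measure G} [μ.IsHaarMeasure]

theorem integrable_smul {E : Type*} [NormedAddCommGroup E] [NormedSpace 𝕜 E] (f : ConvAlg 𝕜 G μ)
    {u : G → E} (hu : Continuous u) : Integrable (fun s => f s • u s) μ :=
  (f.continuous.smul hu).integrable_of_hasCompactSupport f.hasCompactSupport.smul_right

theorem integrable_mul (f : ConvAlg 𝕜 G μ) {u : G → 𝕜} (hu : Continuous u) :
    Integrable (fun s => f s * u s) μ :=
  integrable_smul f hu

theorem conv_continuous (f g : ConvAlg 𝕜 G μ) :
    Continuous fun s => ∫ r, f r * g (r⁻¹ * s) ∂μ := by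
  rw [← continuousOn_univ]
  apply continuousOn_integral_of_compact_support f.hasCompactSupport.isCompact
  · apply Continuous.continuousOn
    have : Continuous fun p : G × G => f p.2 * g (p.2⁻¹ * p.1) := by fun_prop
    exact this
  · intro s r _ hr
    rw [image_eq_zero_of_notMem_tsupport hr, zero_mul]

theorem conv_hasCompactSupport (f g : ConvAlg 𝕜 G μ) :
    HasCompactSupport fun s => ∫ r, f r * g (r⁻¹ * s) ∂μ := by
  refine HasCompactSupport.intro (K := tsupport f * tsupport g)
    (f.hasCompactSupport.isCompact.mul g.hasCompactSupport.isCompact) fun s hs => ?_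
  have : ∀ r, f r * g (r⁻¹ * s) = 0 := by
    intro r
    by_contra h
    exact hs ⟨r, subset_tsupport _ (left_ne_zero_of_mul h), _,
      subset_tsupport _ (right_ne_zero_of_mul h), by simp⟩
  simp [this]

/-- Convolution: `(f * g) s = ∫ f r * g (r⁻¹ * s) dr`. -/
noncomputable instance : Mul (ConvAlg 𝕜 G μ) where
  mul f g := mk (fun s => ∫ r, f r * g (r⁻¹ * s) ∂μ) (conv_continuous f g)
    (conv_hasCompactSupport f g)

theorem mul_apply (f g : ConvAlg 𝕜 G μ) (s : G) :
    (f * g) s = ∫ r, f r * g (r⁻¹ * s) ∂μ := rfl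

theorem conv_assoc (f g h : ConvAlg 𝕜 G μ) : f * g * h = f * (g * h) := by
  ext s
  simp only [mul_apply]
  have h1 : ∀ r, (∫ t, f t * g (t⁻¹ * r) ∂μ) * h (r⁻¹ * s)
      = ∫ t, f t * g (t⁻¹ * r) * h (r⁻¹ * s) ∂μ := fun r => (integral_mul_const _ _).symm
  simp_rw [h1]
  rw [swap_integral μ (K := tsupport f * tsupport g) (L := tsupport f)
    (f.hasCompactSupport.isCompact.mul g.hasCompactSupport.isCompact) f.hasCompactSupport.isCompact]
  · congr 1
    ext t
    rw [← integral_const_mul, ← integral_mul_left_eq_self _ t]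
    congr 1
    ext r
    simp [mul_assoc]
  · fun_prop
  · intro r t hne
    have a := subset_tsupport f (left_ne_zero_of_mul (left_ne_zero_of_mul hne))
    have b := subset_tsupport g (right_ne_zero_of_mul (left_ne_zero_of_mul hne))
    exact ⟨⟨t, a, _, b, by simp⟩, a⟩

noncomputable instance : NonUnitalRing (ConvAlg 𝕜 G μ) where
  left_distrib f g h := by
    ext s
    simp only [mul_apply, add_apply, mul_add]
    exact integral_add (integrable_mul f (by fun_prop)) (integrable_mul f (by fun_prop))
  right_distrib f g h := by
    ext s
    simp only [mul_apply, add_apply, add_mul]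
    exact integral_add (integrable_mul f (by fun_prop)) (integrable_mul g (by fun_prop))
  zero_mul f := by ext s; simp [mul_apply]
  mul_zero f := by ext s; simp [mul_apply]
  mul_assoc := conv_assoc

instance : IsScalarTower 𝕜 (ConvAlg 𝕜 G μ) (ConvAlg 𝕜 G μ) where
  smul_assoc c f g := by
    ext s
    simp only [smul_eq_mul, mul_apply, smul_apply, mul_assoc]
    exact integral_const_mul _ _

instance : SMulCommClass 𝕜 (ConvAlg 𝕜 G μ) (ConvAlg 𝕜 G μ) where
  smul_comm c f g := by
    ext s
    simp only [smul_eq_mul, mul_apply, smul_apply, mul_left_comm _ c]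
    exact (integral_const_mul _ _).symm

theorem star_continuous (f : ConvAlg 𝕜 G μ) :
    Continuous fun s => (modularFunction s⁻¹ : 𝕜) * star (f s⁻¹) := by
  have h : Continuous fun s : G => modularFunction s⁻¹ :=
    continuous_modularFunction.comp continuous_inv
  exact (RCLike.continuous_ofReal.comp h).mul (by fun_prop)

theorem star_hasCompactSupport (f : ConvAlg 𝕜 G μ) :
    HasCompactSupport fun s => (modularFunction s⁻¹ : 𝕜) * star (f s⁻¹) := by
  refine HasCompactSupport.intro (K := (tsupport f)⁻¹) f.hasCompactSupport.isCompact.inv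
    fun s hs => ?_
  have : f s⁻¹ = 0 := image_eq_zero_of_notMem_tsupport (by simpa using hs)
  simp [this]

/-- The involution: `f⋆ s = Δ(s⁻¹) * conj (f s⁻¹)`. -/
noncomputable instance : Star (ConvAlg 𝕜 G μ) where
  star f := mk (fun s => (modularFunction s⁻¹ : 𝕜) * star (f s⁻¹)) (star_continuous f)
    (star_hasCompactSupport f)

theorem star_apply (f : ConvAlg 𝕜 G μ) (s : G) :
    (star f) s = (modularFunction s⁻¹ : 𝕜) * star (f s⁻¹) := rfl

noncomputable instance : StarRing (ConvAlg 𝕜 G μ) where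
  star_involutive f := by
    ext s
    have h : ((modularFunction s : ℝ) : 𝕜) ≠ 0 := by
      exact_mod_cast (modularFunction_pos s).ne'
    simp [star_apply, modularFunction_inv, h]
  star_add f g := by ext s; simp [star_apply, mul_add]
  star_mul f g := by
    ext s
    simp only [star_apply, mul_apply]
    conv_rhs => rw [← integral_mul_left_eq_self _ s]
    simp only [RCLike.star_def, ← integral_conj, mul_inv_rev, inv_inv]
    rw [← integral_const_mul]
    congr 1
    ext r
    have h : ((modularFunction s : ℝ) : 𝕜) ≠ 0 := by
      exact_mod_cast (modularFunction_pos s).ne'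
    have h' : ((modularFunction r : ℝ) : 𝕜) ≠ 0 := by
      exact_mod_cast (modularFunction_pos r).ne'
    simp [modularFunction_inv, modularFunction_mul]
    field_simp

instance : StarModule 𝕜 (ConvAlg 𝕜 G μ) where
  star_smul c f := by ext s; simp [star_apply, mul_left_comm]

end Algebra

end ConvAlg

/-- A (bundled) Hilbert space over `𝕜`. -/
structure HilbertSpace (𝕜 : Type w) [RCLike 𝕜] : Type (max w (v + 1)) where
  /-- The underlying type. -/
  carrier : Type v
  [normedAddCommGroup : NormedAddCommGroup carrier]
  [innerProductSpace : InnerProductSpace 𝕜 carrier]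
  [completeSpace : CompleteSpace carrier]

namespace HilbertSpace

variable {𝕜 : Type w} [RCLike 𝕜]

instance : CoeSort (HilbertSpace.{w, v} 𝕜) (Type v) := ⟨HilbertSpace.carrier⟩

instance (X : HilbertSpace.{w, v} 𝕜) : NormedAddCommGroup X := X.normedAddCommGroup

instance (X : HilbertSpace.{w, v} 𝕜) : InnerProductSpace 𝕜 X := X.innerProductSpace

instance (X : HilbertSpace.{w, v} 𝕜) : CompleteSpace X := X.completeSpace

/-- The underlying real normed space, which the vector-valued integral refers to. -/
noncomputable instance (X : HilbertSpace.{w, v} 𝕜) : NormedSpace ℝ X :=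
  NormedSpace.restrictScalars ℝ 𝕜 X

instance (X : HilbertSpace.{w, v} 𝕜) : IsScalarTower ℝ 𝕜 X where
  smul_assoc a b x := by
    rw [Algebra.smul_def, mul_smul]
    rfl

theorem real_smul_eq (X : HilbertSpace.{w, v} 𝕜) (a : ℝ) (x : X) : a • x = (a : 𝕜) • x := by
  rw [← one_smul 𝕜 x, ← smul_assoc, RCLike.real_smul_eq_coe_mul, mul_one, one_smul]

instance (X : HilbertSpace.{w, v} 𝕜) : SMulCommClass ℝ 𝕜 X where
  smul_comm a b x := by rw [real_smul_eq, real_smul_eq, smul_comm]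

end HilbertSpace

section Rep

variable {𝕜 : Type w} [RCLike 𝕜] (G : Type u) [Group G] [TopologicalSpace G]

/-- A unitary strongly continuous representation of `G` on the Hilbert space `X`. -/
structure UnitaryRep (X : HilbertSpace.{w, v} 𝕜) where
  /-- The underlying homomorphism into the unitary group of `X`. -/
  toHom : G →* unitary (X →L[𝕜] X)
  continuous_apply' : ∀ x : X, Continuous fun s => (toHom s : X →L[𝕜] X) x

end Rep

namespace UnitaryRep

section Basic

variable {𝕜 : Type w} [RCLike 𝕜] {G : Type u} [Group G] [TopologicalSpace G]
  {X : HilbertSpace.{w, v} 𝕜}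

noncomputable instance : CoeFun (UnitaryRep G X) fun _ => G → (X →L[𝕜] X) :=
  ⟨fun U s => (U.toHom s : X →L[𝕜] X)⟩

@[ext] theorem ext {U V : UnitaryRep G X} (h : ∀ s, U s = V s) : U = V := by
  cases U; cases V
  congr 1
  ext1 s
  exact Subtype.ext (h s)

theorem map_mul (U : UnitaryRep G X) (r s : G) : U (r * s) = U r * U s := by simp

theorem map_one (U : UnitaryRep G X) : U 1 = 1 := by simp

theorem continuous_apply (U : UnitaryRep G X) (x : X) : Continuous fun s => U s x :=
  U.continuous_apply' x

theorem inner_inv_left (U : UnitaryRep G X) (s : G) (x y : X) :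
    inner 𝕜 (U s⁻¹ x) y = inner 𝕜 x (U s y) := by
  have h : U s⁻¹ = star (U s) := by
    simp [_root_.map_inv, ← Unitary.star_eq_inv]
  rw [h, ContinuousLinearMap.star_eq_adjoint, ContinuousLinearMap.adjoint_inner_left]

theorem norm_apply (U : UnitaryRep G X) (s : G) (x : X) : ‖U s x‖ = ‖x‖ := by
  have h : inner 𝕜 (U s x) (U s x) = inner 𝕜 x x := by
    rw [← inner_inv_left, ← mul_apply_eq_comp, ← map_mul, inv_mul_cancel, map_one,
      one_apply_eq_self]
  rw [@norm_eq_sqrt_re_inner 𝕜, h, ← @norm_eq_sqrt_re_inner 𝕜]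

end Basic

section Integrated

variable {𝕜 : Type w} [RCLike 𝕜] {G : Type u} [Group G] [TopologicalSpace G]
  [IsTopologicalGroup G] [LocallyCompactSpace G] [MeasurableSpace G] [BorelSpace G]
  {μ : Measure G} [μ.IsHaarMeasure] {X : HilbertSpace.{w, v} 𝕜}

/-- The operator `U(f) = ∫ f s • U s ds`, given by `U(f) x = ∫ f s • U s x ds` for `x` in `X`. -/
noncomputable def integral (U : UnitaryRep G X) (f : ConvAlg 𝕜 G μ) : X →L[𝕜] X :=
  LinearMap.mkContinuous
    { toFun := fun x => ∫ s, f s • U s x ∂μ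
      map_add' := fun x y => by
        simp only [_root_.map_add, smul_add]
        exact integral_add (f.integrable_smul (U.continuous_apply x))
          (f.integrable_smul (U.continuous_apply y))
      map_smul' := fun c x => by
        simp only [_root_.map_smul, smul_comm _ c, RingHom.id_apply]
        exact integral_smul c _ }
    f.l1norm
    (fun x => by
      refine (norm_integral_le_integral_norm _).trans (le_of_eq ?_)
      simp only [norm_smul, norm_apply]
      exact integral_mul_const _ _)

theorem integral_apply (U : UnitaryRep G X) (f : ConvAlg 𝕜 G μ) (x : X) :
    U.integral f x = ∫ s, f s • U s x ∂μ := rfl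

theorem norm_integral_le (U : UnitaryRep G X) (f : ConvAlg 𝕜 G μ) :
    ‖U.integral f‖ ≤ f.l1norm :=
  LinearMap.mkContinuous_norm_le _ (integral_nonneg fun _ => norm_nonneg _) _

theorem integral_add' (U : UnitaryRep G X) (f g : ConvAlg 𝕜 G μ) :
    U.integral (f + g) = U.integral f + U.integral g := by
  ext x
  simp only [integral_apply, ConvAlg.add_apply, add_smul, _root_.add_apply]
  exact integral_add (f.integrable_smul (U.continuous_apply x))
    (g.integrable_smul (U.continuous_apply x))

theorem integral_smul' (U : UnitaryRep G X) (c : 𝕜) (f : ConvAlg 𝕜 G μ) :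
    U.integral (c • f) = c • U.integral f := by
  ext x
  simp only [integral_apply, ConvAlg.smul_apply, mul_smul, _root_.smul_apply]
  exact integral_smul c _

theorem integral_mul' (U : UnitaryRep G X) (f g : ConvAlg 𝕜 G μ) :
    U.integral (f * g) = U.integral f * U.integral g := by
  ext x
  simp only [integral_apply, ConvAlg.mul_apply, mul_apply_eq_comp]
  have h1 : ∀ s, (∫ r, f r * g (r⁻¹ * s) ∂μ) • U s x
      = ∫ r, (f r * g (r⁻¹ * s)) • U s x ∂μ := fun s => (integral_smul_const _ _).symm
  simp_rw [h1]
  have hU := U.continuous_apply x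
  rw [swap_integral μ (K := tsupport f * tsupport g) (L := tsupport f)
    (f.hasCompactSupport.isCompact.mul g.hasCompactSupport.isCompact) f.hasCompactSupport.isCompact]
  · congr 1
    ext r
    rw [← ContinuousLinearMap.integral_comp_comm _ (g.integrable_smul hU), ← integral_smul,
      ← integral_mul_left_eq_self _ r]
    congr 1
    ext s
    simp [mul_smul]
  · have : Continuous fun p : G × G => U p.1 x := hU.comp continuous_fst
    fun_prop
  · intro s r hne
    have a := subset_tsupport f (left_ne_zero_of_mul (left_ne_zero_of_smul hne))
    have b := subset_tsupport g (right_ne_zero_of_mul (left_ne_zero_of_smul hne))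
    exact ⟨⟨r, a, _, b, by simp⟩, a⟩

theorem integral_star' (U : UnitaryRep G X) (f : ConvAlg 𝕜 G μ) :
    U.integral (star f) = star (U.integral f) := by
  rw [ContinuousLinearMap.star_eq_adjoint, ContinuousLinearMap.eq_adjoint_iff]
  intro x y
  have hc : Continuous fun s => U s⁻¹ x := (U.continuous_apply x).comp continuous_inv
  have hcont : Continuous fun s => star (f s) • U s⁻¹ x := by fun_prop
  have hsupp : HasCompactSupport fun s => star (f s) • U s⁻¹ x :=
    HasCompactSupport.smul_right (f.hasCompactSupport.comp_left (star_zero 𝕜))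
  have h1 : U.integral (star f) x = ∫ s, star (f s) • U s⁻¹ x ∂μ := by
    rw [integral_apply, ← integral_modularFunction_inv μ hcont hsupp]
    congr 1
    ext s
    rw [inv_inv, ConvAlg.star_apply, mul_smul, HilbertSpace.real_smul_eq]
  have hi : Integrable (fun s => star (f s) • U s⁻¹ x) μ :=
    hcont.integrable_of_hasCompactSupport hsupp
  have hi' := f.integrable_smul (μ := μ) (U.continuous_apply y)
  rw [h1, integral_apply, ← integral_inner hi', ← inner_conj_symm, ← integral_inner hi,
    ← integral_conj]
  congr 1
  ext s
  rw [inner_conj_symm, inner_smul_left, inner_smul_right, inner_inv_left]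
  simp

/-- The integrated form `f ↦ U(f) = ∫ f s • U s ds` of `U`, as an involutive representation of the
convolution algebra `C_c(G)`. -/
noncomputable def integratedForm (U : UnitaryRep G X) : ConvAlg 𝕜 G μ →⋆ₙₐ[𝕜] (X →L[𝕜] X) where
  toFun := U.integral
  map_smul' := U.integral_smul'
  map_zero' := by ext x; simp [integral_apply]
  map_add' := U.integral_add'
  map_mul' := U.integral_mul'
  map_star' := U.integral_star'

theorem integratedForm_apply (U : UnitaryRep G X) (f : ConvAlg 𝕜 G μ) (x : X) :
    U.integratedForm f x = ∫ s, f s • U s x ∂μ := rfl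

theorem norm_integratedForm_le (U : UnitaryRep G X) (f : ConvAlg 𝕜 G μ) :
    ‖U.integratedForm f‖ ≤ f.l1norm := U.norm_integral_le f

end Integrated

end UnitaryRep

section Completion

open UniformSpace Completion

variable (A : Type*) [NonUnitalSeminormedRing A]

/-- The product on the completion of a seminormed algebra: the continuous extension. -/
noncomputable abbrev completionMul : Mul (Completion A) where
  mul := Function.curry <| (isDenseInducing_coe.prodMap isDenseInducing_coe).extend
    ((↑) ∘ Function.uncurry (fun a b : A => a * b))

theorem completion_coe_mul (a b : A) : letI := completionMul A
    ((a * b : A) : Completion A) = (a : Completion A) * (b : Completion A) :=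
  ((isDenseInducing_coe.prodMap isDenseInducing_coe).extend_eq
      ((continuous_coe A).comp (@continuous_mul A _ _ _)) (a, b)).symm

theorem completion_continuousMul : letI := completionMul A
    ContinuousMul (Completion A) := by
  let := completionMul A
  constructor
  let m := (AddMonoidHom.mul : A →+ A →+ A).compr₂ toCompl
  have : Continuous fun p : A × A => m p.1 p.2 := (continuous_coe A).comp continuous_mul
  have di : IsDenseInducing (toCompl : A → Completion A) := isDenseInducing_coe
  exact (di.extend_Z_bilin di this :)

/-- The completion of a seminormed algebra is a Banach algebra. -/
noncomputable abbrev completionNonUnitalNormedRing : NonUnitalNormedRing (Completion A) :=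
  letI := completionMul A
  haveI := completion_continuousMul A
  have cm := completion_coe_mul A
  { (inferInstance : NormedAddCommGroup (Completion A)), completionMul A with
    zero_mul := fun a =>
      Completion.induction_on a (isClosed_eq (by fun_prop) continuous_const)
        fun a => by rw [← Completion.coe_zero, ← cm, zero_mul]
    mul_zero := fun a =>
      Completion.induction_on a (isClosed_eq (by fun_prop) continuous_const)
        fun a ↦ by rw [← Completion.coe_zero, ← cm, mul_zero]
    mul_assoc := fun a b c =>
      Completion.induction_on₃ a b c
        (isClosed_eq (by fun_prop) (by fun_prop))
        fun a b c => by rw [← cm, ← cm, ← cm, ← cm, mul_assoc]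
    left_distrib := fun a b c =>
      Completion.induction_on₃ a b c
        (isClosed_eq (by fun_prop) (by fun_prop))
        fun a b c => by rw [← Completion.coe_add, ← cm, ← cm, ← cm, ← Completion.coe_add, mul_add]
    right_distrib := fun a b c =>
      Completion.induction_on₃ a b c
        (isClosed_eq (by fun_prop) (by fun_prop))
        fun a b c => by rw [← Completion.coe_add, ← cm, ← cm, ← cm, ← Completion.coe_add, add_mul]
    norm_mul_le := fun a b =>
      Completion.induction_on₂ a b (isClosed_le (by fun_prop) (by fun_prop))
        fun a b => by simpa only [← cm, norm_coe] using norm_mul_le a b }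

end Completion

variable {𝕜 : Type w} [RCLike 𝕜] {G : Type u} [Group G] [TopologicalSpace G]
  [IsTopologicalGroup G] [LocallyCompactSpace G] [MeasurableSpace G] [BorelSpace G]

section Seminorm

variable (μ : Measure G) [μ.IsHaarMeasure] (𝓗 : Set (HilbertSpace.{w, v} 𝕜))

variable (G) in
/-- The class `𝓡` of all unitary strongly continuous representations of `G` in the Hilbert spaces
from the class `𝓗`. -/
abbrev UnitaryReps : Type _ := (X : 𝓗) × UnitaryRep G X.1

theorem bddAbove_norm (f : ConvAlg 𝕜 G μ) :
    BddAbove (range fun U : UnitaryReps G 𝓗 => ‖U.2.integratedForm f‖) :=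
  ⟨f.l1norm, by rintro _ ⟨U, rfl⟩; exact U.2.norm_integratedForm_le f⟩

/-- The seminorm `σ(f) = sup ‖U(f)‖` on `C_c(G)`, where the supremum is over the class `𝓡` of all
unitary strongly continuous representations `U` of `G` in the spaces from `𝓗`. -/
noncomputable def sigma : Seminorm 𝕜 (ConvAlg 𝕜 G μ) :=
  Seminorm.of (fun f => ⨆ U : UnitaryReps G 𝓗, ‖U.2.integratedForm f‖)
    (fun f g => Real.iSup_le
      (fun U => by
        rw [_root_.map_add]
        exact (norm_add_le _ _).trans (add_le_add (le_ciSup (bddAbove_norm μ 𝓗 f) U)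
          (le_ciSup (bddAbove_norm μ 𝓗 g) U)))
      (add_nonneg (Real.iSup_nonneg fun _ => norm_nonneg _)
        (Real.iSup_nonneg fun _ => norm_nonneg _)))
    (fun c f => by
      simp only [_root_.map_smul, norm_smul]
      exact (Real.mul_iSup_of_nonneg (norm_nonneg c) _).symm)

theorem sigma_apply (f : ConvAlg 𝕜 G μ) :
    sigma μ 𝓗 f = ⨆ U : UnitaryReps G 𝓗, ‖U.2.integratedForm f‖ := rfl

theorem norm_le_sigma (U : UnitaryReps G 𝓗) (f : ConvAlg 𝕜 G μ) :
    ‖U.2.integratedForm f‖ ≤ sigma μ 𝓗 f :=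
  le_ciSup (bddAbove_norm μ 𝓗 f) U

theorem sigma_mul_le (f g : ConvAlg 𝕜 G μ) : sigma μ 𝓗 (f * g) ≤ sigma μ 𝓗 f * sigma μ 𝓗 g :=
  Real.iSup_le
    (fun U => by
      rw [_root_.map_mul]
      exact (norm_mul_le _ _).trans (mul_le_mul (norm_le_sigma μ 𝓗 U f) (norm_le_sigma μ 𝓗 U g)
        (norm_nonneg _) (apply_nonneg _ _)))
    (mul_nonneg (apply_nonneg _ _) (apply_nonneg _ _))

theorem sigma_star (f : ConvAlg 𝕜 G μ) : sigma μ 𝓗 (star f) = sigma μ 𝓗 f := by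
  have h : ∀ U : UnitaryReps G 𝓗, ‖U.2.integratedForm (star f)‖ = ‖U.2.integratedForm f‖ := by
    intro U
    rw [map_star]
    exact norm_star (U.2.integratedForm f)
  simp only [sigma_apply, h]

theorem sigma_mul_self_le (f : ConvAlg 𝕜 G μ) :
    sigma μ 𝓗 f * sigma μ 𝓗 f ≤ sigma μ 𝓗 (star f * f) := by
  have h : sigma μ 𝓗 f ≤ Real.sqrt (sigma μ 𝓗 (star f * f)) := by
    refine Real.iSup_le (fun U => ?_) (Real.sqrt_nonneg _)
    refine Real.le_sqrt_of_sq_le ?_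
    refine le_trans (le_of_eq ?_) (norm_le_sigma μ 𝓗 U (star f * f))
    rw [_root_.map_mul, map_star, sq]
    exact CStarRing.norm_star_mul_self.symm
  have h0 : 0 ≤ sigma μ 𝓗 f := apply_nonneg _ _
  calc sigma μ 𝓗 f * sigma μ 𝓗 f
      ≤ Real.sqrt (sigma μ 𝓗 (star f * f)) * Real.sqrt (sigma μ 𝓗 (star f * f)) :=
        mul_le_mul h h h0 (Real.sqrt_nonneg _)
    _ = _ := Real.mul_self_sqrt (apply_nonneg _ _)

/-- The algebra `C_c(G)`, seminormed by `σ`. -/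
def PreCrossedProduct (μ : Measure G) (_𝓗 : Set (HilbertSpace.{w, v} 𝕜)) : Type _ := ConvAlg 𝕜 G μ

end Seminorm

namespace PreCrossedProduct

variable {μ : Measure G} [μ.IsHaarMeasure] {𝓗 : Set (HilbertSpace.{w, v} 𝕜)}

noncomputable instance : NonUnitalRing (PreCrossedProduct μ 𝓗) :=
  inferInstanceAs (NonUnitalRing (ConvAlg 𝕜 G μ))

noncomputable instance : Module 𝕜 (PreCrossedProduct μ 𝓗) :=
  inferInstanceAs (Module 𝕜 (ConvAlg 𝕜 G μ))

noncomputable instance : StarRing (PreCrossedProduct μ 𝓗) :=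
  inferInstanceAs (StarRing (ConvAlg 𝕜 G μ))

instance : StarModule 𝕜 (PreCrossedProduct μ 𝓗) :=
  inferInstanceAs (StarModule 𝕜 (ConvAlg 𝕜 G μ))

instance : IsScalarTower 𝕜 (PreCrossedProduct μ 𝓗) (PreCrossedProduct μ 𝓗) :=
  inferInstanceAs (IsScalarTower 𝕜 (ConvAlg 𝕜 G μ) (ConvAlg 𝕜 G μ))

instance : SMulCommClass 𝕜 (PreCrossedProduct μ 𝓗) (PreCrossedProduct μ 𝓗) :=
  inferInstanceAs (SMulCommClass 𝕜 (ConvAlg 𝕜 G μ) (ConvAlg 𝕜 G μ))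

noncomputable instance : NonUnitalSeminormedRing (PreCrossedProduct μ 𝓗) :=
  { (inferInstance : NonUnitalRing (PreCrossedProduct μ 𝓗)),
    (sigma μ 𝓗).toAddGroupSeminorm.toSeminormedAddCommGroup.toPseudoMetricSpace with
    norm := sigma (𝕜 := 𝕜) μ 𝓗
    dist_eq := (sigma μ 𝓗).toAddGroupSeminorm.toSeminormedAddCommGroup.dist_eq
    norm_mul_le := sigma_mul_le μ 𝓗 }

theorem norm_def (f : PreCrossedProduct μ 𝓗) : ‖f‖ = sigma (𝕜 := 𝕜) μ 𝓗 f := rfl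

noncomputable instance : NormedSpace 𝕜 (PreCrossedProduct μ 𝓗) where
  __ := (inferInstance : Module 𝕜 (PreCrossedProduct μ 𝓗))
  norm_smul_le c f := (map_smul_eq_mul (sigma μ 𝓗) c f).le

instance : NormedStarGroup (PreCrossedProduct μ 𝓗) where
  norm_star_le f := (sigma_star μ 𝓗 f).le

end PreCrossedProduct

/-- The crossed product `(𝕜 ⋊ G)^𝓡`: the completion of `C_c(G) / ker σ` in the norm induced by `σ`
(the Hausdorff completion of `C_c(G)` for the seminorm `σ`). -/
def CrossedProduct (μ : Measure G) [μ.IsHaarMeasure] (𝓗 : Set (HilbertSpace.{w, v} 𝕜)) : Type _ :=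
  UniformSpace.Completion (PreCrossedProduct μ 𝓗)

namespace CrossedProduct

open UniformSpace

variable {μ : Measure G} [μ.IsHaarMeasure] {𝓗 : Set (HilbertSpace.{w, v} 𝕜)}

noncomputable instance : NonUnitalNormedRing (CrossedProduct μ 𝓗) :=
  completionNonUnitalNormedRing (PreCrossedProduct μ 𝓗)

noncomputable instance : NormedSpace 𝕜 (CrossedProduct μ 𝓗) :=
  inferInstanceAs (NormedSpace 𝕜 (Completion (PreCrossedProduct μ 𝓗)))

instance : CompleteSpace (CrossedProduct μ 𝓗) :=
  inferInstanceAs (CompleteSpace (Completion (PreCrossedProduct μ 𝓗)))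

/-- The canonical map from `C_c(G)` into the crossed product. -/
noncomputable def ofFun (f : ConvAlg 𝕜 G μ) : CrossedProduct μ 𝓗 :=
  Completion.coe' (show PreCrossedProduct μ 𝓗 from f)

theorem induction_on {p : CrossedProduct μ 𝓗 → Prop} (a : CrossedProduct μ 𝓗)
    (hp : IsClosed {a | p a}) (ih : ∀ f, p (ofFun f)) : p a :=
  Completion.induction_on a hp ih

theorem ofFun_add (f g : ConvAlg 𝕜 G μ) :
    (ofFun (f + g) : CrossedProduct μ 𝓗) = ofFun f + ofFun g :=
  Completion.coe_add (α := PreCrossedProduct μ 𝓗) f g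

theorem ofFun_smul (c : 𝕜) (f : ConvAlg 𝕜 G μ) :
    (ofFun (c • f) : CrossedProduct μ 𝓗) = c • ofFun f :=
  Completion.coe_smul (X := PreCrossedProduct μ 𝓗) c f

theorem ofFun_mul (f g : ConvAlg 𝕜 G μ) :
    (ofFun (f * g) : CrossedProduct μ 𝓗) = ofFun f * ofFun g :=
  completion_coe_mul (PreCrossedProduct μ 𝓗) f g

theorem norm_ofFun (f : ConvAlg 𝕜 G μ) :
    ‖(ofFun f : CrossedProduct μ 𝓗)‖ = sigma μ 𝓗 f :=
  Completion.norm_coe (E := PreCrossedProduct μ 𝓗) f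

/-- The involution of the crossed product: the continuous extension of that of `C_c(G)`. -/
noncomputable instance : Star (CrossedProduct μ 𝓗) where
  star := Completion.map (star : PreCrossedProduct μ 𝓗 → PreCrossedProduct μ 𝓗)

theorem star_ofFun (f : ConvAlg 𝕜 G μ) :
    star (ofFun f : CrossedProduct μ 𝓗) = ofFun (star f) :=
  Completion.map_coe (star_isometry (E := PreCrossedProduct μ 𝓗)).uniformContinuous f

theorem continuous_star' : Continuous (star : CrossedProduct μ 𝓗 → CrossedProduct μ 𝓗) :=
  Completion.continuous_map

instance : IsScalarTower 𝕜 (CrossedProduct μ 𝓗) (CrossedProduct μ 𝓗) where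
  smul_assoc c a b := by
    simp only [smul_eq_mul]
    induction a using CrossedProduct.induction_on with
    | hp => exact isClosed_eq ((continuous_const_smul c).mul continuous_const) ((continuous_id.mul continuous_const).const_smul c)
    | ih f => ?_
    induction b using CrossedProduct.induction_on with
    | hp => exact isClosed_eq (continuous_const.mul continuous_id) ((continuous_const.mul continuous_id).const_smul c)
    | ih g => ?_
    rw [← ofFun_smul, ← ofFun_mul, ← ofFun_mul, ← ofFun_smul, smul_mul_assoc]

instance : SMulCommClass 𝕜 (CrossedProduct μ 𝓗) (CrossedProduct μ 𝓗) where
  smul_comm c a b := by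
    simp only [smul_eq_mul]
    induction a using CrossedProduct.induction_on with
    | hp => exact isClosed_eq ((continuous_id.mul continuous_const).const_smul c) (continuous_id.mul continuous_const)
    | ih f => ?_
    induction b using CrossedProduct.induction_on with
    | hp => exact isClosed_eq ((continuous_const.mul continuous_id).const_smul c) (continuous_const.mul (continuous_const_smul c))
    | ih g => ?_
    rw [← ofFun_smul, ← ofFun_mul, ← ofFun_mul, ← ofFun_smul, mul_smul_comm]

noncomputable instance : StarRing (CrossedProduct μ 𝓗) where
  star_involutive a := by
    have h := continuous_star' (μ := μ) (𝓗 := 𝓗)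
    induction a using CrossedProduct.induction_on with
    | hp => exact isClosed_eq (h.comp h) continuous_id
    | ih f => ?_
    rw [star_ofFun, star_ofFun, star_star]
  star_add a b := by
    have h := continuous_star' (μ := μ) (𝓗 := 𝓗)
    induction a using CrossedProduct.induction_on with
    | hp => exact isClosed_eq (by fun_prop) (by fun_prop)
    | ih f => ?_
    induction b using CrossedProduct.induction_on with
    | hp => exact isClosed_eq (by fun_prop) (by fun_prop)
    | ih g => ?_
    rw [← ofFun_add, star_ofFun, star_ofFun, star_ofFun, ← ofFun_add, star_add]
  star_mul a b := by
    have h := continuous_star' (μ := μ) (𝓗 := 𝓗)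
    induction a using CrossedProduct.induction_on with
    | hp => exact isClosed_eq (by fun_prop) (by fun_prop)
    | ih f => ?_
    induction b using CrossedProduct.induction_on with
    | hp => exact isClosed_eq (by fun_prop) (by fun_prop)
    | ih g => ?_
    rw [← ofFun_mul, star_ofFun, star_ofFun, star_ofFun, ← ofFun_mul, star_mul]

instance : StarModule 𝕜 (CrossedProduct μ 𝓗) where
  star_smul c a := by
    have h := continuous_star' (μ := μ) (𝓗 := 𝓗)
    induction a using CrossedProduct.induction_on with
    | hp => exact isClosed_eq (h.comp (continuous_const_smul c)) ((continuous_const_smul (star c)).comp h)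
    | ih f => ?_
    rw [← ofFun_smul, star_ofFun, star_ofFun, ← ofFun_smul, star_smul]

instance : CStarRing (CrossedProduct μ 𝓗) where
  norm_mul_self_le a := by
    have h := continuous_star' (μ := μ) (𝓗 := 𝓗)
    induction a using CrossedProduct.induction_on with
    | hp => exact isClosed_le (by fun_prop) (by fun_prop)
    | ih f => ?_
    rw [star_ofFun, ← ofFun_mul, norm_ofFun, norm_ofFun]
    exact sigma_mul_self_le μ 𝓗 f

/-- For complex scalars, the crossed product is a C⋆-algebra. -/
noncomputable instance {𝓗 : Set (HilbertSpace.{0, v} ℂ)} :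
    NonUnitalCStarAlgebra (CrossedProduct μ 𝓗) where

variable (μ 𝓗) in
/-- The canonical map `q` from `C_c(G)` into the crossed product, as a homomorphism of involutive
algebras. -/
noncomputable def q : ConvAlg 𝕜 G μ →⋆ₙₐ[𝕜] CrossedProduct μ 𝓗 where
  toFun := ofFun
  map_smul' := ofFun_smul
  map_zero' := Completion.coe_zero (α := PreCrossedProduct μ 𝓗)
  map_add' := ofFun_add
  map_mul' := ofFun_mul
  map_star' f := (star_ofFun f).symm

theorem norm_q (f : ConvAlg 𝕜 G μ) : ‖q μ 𝓗 f‖ = sigma μ 𝓗 f := norm_ofFun f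

theorem denseRange_q : DenseRange (q μ 𝓗) :=
  Completion.denseRange_coe (α := PreCrossedProduct μ 𝓗)

end CrossedProduct

namespace UnitaryRep

open UniformSpace

variable {μ : Measure G} [μ.IsHaarMeasure] {𝓗 : Set (HilbertSpace.{w, v} 𝕜)} {X : 𝓗}

/-- The extension of the integrated form of `U` to the crossed product, as a function. -/
noncomputable def crossedRepFun (U : UnitaryRep G X.1) :
    CrossedProduct μ 𝓗 → (X.1 →L[𝕜] X.1) :=
  Completion.extension (α := PreCrossedProduct μ 𝓗) U.integratedForm

theorem crossedRepFun_uniformContinuous (U : UnitaryRep G X.1) :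
    UniformContinuous (α := PreCrossedProduct μ 𝓗) U.integratedForm := by
  refine (LipschitzWith.of_dist_le_mul (K := 1) fun f g => ?_).uniformContinuous
  rw [dist_eq_norm, dist_eq_norm, NNReal.coe_one, one_mul]
  have h := norm_le_sigma μ 𝓗 ⟨X, U⟩ (f - g : PreCrossedProduct μ 𝓗)
  rw [← PreCrossedProduct.norm_def] at h
  refine le_trans (le_of_eq ?_) h
  congr 1
  exact (_root_.map_sub (U.integratedForm (μ := μ)) f g).symm

theorem crossedRepFun_q (U : UnitaryRep G X.1) (f : ConvAlg 𝕜 G μ) :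
    U.crossedRepFun (CrossedProduct.q μ 𝓗 f) = U.integratedForm f :=
  Completion.extension_coe (α := PreCrossedProduct μ 𝓗) U.crossedRepFun_uniformContinuous f

theorem crossedRepFun_continuous (U : UnitaryRep G X.1) :
    Continuous (U.crossedRepFun : CrossedProduct μ 𝓗 → _) :=
  Completion.continuous_extension

/-- The involutive representation `U^𝓡` of the crossed product associated with a unitary strongly
continuous representation `U` of `G` in a space from `𝓗`. It is the continuous extension of the
integrated form, so that `U^𝓡(q(f)) = ∫ f s • U s ds`. -/
noncomputable def crossedRep (U : UnitaryRep G X.1) :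
    CrossedProduct μ 𝓗 →⋆ₙₐ[𝕜] (X.1 →L[𝕜] X.1) where
  toFun := U.crossedRepFun
  map_zero' := by
    rw [← _root_.map_zero (CrossedProduct.q μ 𝓗), crossedRepFun_q, _root_.map_zero]
  map_smul' c a := by
    have h := U.crossedRepFun_continuous (μ := μ)
    induction a using CrossedProduct.induction_on with
    | hp => exact isClosed_eq (h.comp (continuous_const_smul c)) (h.const_smul c)
    | ih f => ?_
    · change U.crossedRepFun (c • CrossedProduct.q μ 𝓗 f) = c • U.crossedRepFun
        (CrossedProduct.q μ 𝓗 f)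
      rw [← _root_.map_smul, crossedRepFun_q, crossedRepFun_q, _root_.map_smul]
  map_add' a b := by
    have h := U.crossedRepFun_continuous (μ := μ)
    induction a using CrossedProduct.induction_on with
    | hp => exact isClosed_eq (by fun_prop) (by fun_prop)
    | ih f => ?_
    induction b using CrossedProduct.induction_on with
    | hp => exact isClosed_eq (by fun_prop) (by fun_prop)
    | ih g => ?_
    change U.crossedRepFun (CrossedProduct.q μ 𝓗 f + CrossedProduct.q μ 𝓗 g) =
      U.crossedRepFun (CrossedProduct.q μ 𝓗 f) + U.crossedRepFun (CrossedProduct.q μ 𝓗 g)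
    rw [← _root_.map_add, crossedRepFun_q, crossedRepFun_q, crossedRepFun_q, _root_.map_add]
  map_mul' a b := by
    have h := U.crossedRepFun_continuous (μ := μ)
    induction a using CrossedProduct.induction_on with
    | hp => exact isClosed_eq (by fun_prop) (by fun_prop)
    | ih f => ?_
    induction b using CrossedProduct.induction_on with
    | hp => exact isClosed_eq (by fun_prop) (by fun_prop)
    | ih g => ?_
    change U.crossedRepFun (CrossedProduct.q μ 𝓗 f * CrossedProduct.q μ 𝓗 g) =
      U.crossedRepFun (CrossedProduct.q μ 𝓗 f) * U.crossedRepFun (CrossedProduct.q μ 𝓗 g)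
    rw [← _root_.map_mul, crossedRepFun_q, crossedRepFun_q, crossedRepFun_q, _root_.map_mul]
  map_star' a := by
    have h := U.crossedRepFun_continuous (μ := μ)
    have h' := CrossedProduct.continuous_star' (μ := μ) (𝓗 := 𝓗)
    induction a using CrossedProduct.induction_on with
    | hp => exact isClosed_eq (by fun_prop) (by fun_prop)
    | ih f => ?_
    change U.crossedRepFun (star (CrossedProduct.q μ 𝓗 f)) =
      star (U.crossedRepFun (CrossedProduct.q μ 𝓗 f))
    rw [← map_star, crossedRepFun_q, crossedRepFun_q, map_star]

theorem crossedRep_q (U : UnitaryRep G X.1) (f : ConvAlg 𝕜 G μ) :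
    U.crossedRep (CrossedProduct.q μ 𝓗 f) = U.integratedForm f :=
  U.crossedRepFun_q f

end UnitaryRep

section Predicates

/-- A representation `T` of an algebra `A` on `X` is non-degenerate if the linear span of all
`T a x` is dense in `X`. -/
def IsNondegenerate {A : Type*} [NonUnitalNonAssocSemiring A] [DistribMulAction 𝕜 A] [Star A]
    {X : HilbertSpace.{w, v} 𝕜} (T : A →⋆ₙₐ[𝕜] (X →L[𝕜] X)) : Prop :=
  Dense (Submodule.span 𝕜 {y : X | ∃ a x, T a x = y} : Set X)

/-- The closed subspaces of `X` that are invariant under all members of a family of operators. -/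
def closedInvariantSubspaces {ι : Type*} {X : HilbertSpace.{w, v} 𝕜} (S : ι → (X →L[𝕜] X)) :
    Set (Submodule 𝕜 X) :=
  {Z | IsClosed (Z : Set X) ∧ ∀ i, ∀ x ∈ Z, S i x ∈ Z}

/-- The space of bounded intertwining operators `Φ : X → Y` between two families of operators on
`X` and `Y`, as a subspace of the Banach space of all bounded operators from `X` to `Y`. -/
def intertwiners {ι : Type*} {X Y : HilbertSpace.{w, v} 𝕜} (S : ι → (X →L[𝕜] X))
    (T : ι → (Y →L[𝕜] Y)) : Submodule 𝕜 (X →L[𝕜] Y) where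
  carrier := {Φ | ∀ i, T i ∘L Φ = Φ ∘L S i}
  zero_mem' := by intro i; simp
  add_mem' := by intro Φ Ψ hΦ hΨ i; simp [hΦ i, hΨ i]
  smul_mem' := by intro c Φ hΦ i; simp [hΦ i]

/-- The set of all numbers `‖π f‖`, where `π` runs over the non-degenerate involutive
representations of the convolution algebra `C_c(G)` in Hilbert spaces (of universe level `v`) that
are contractive for the `L¹`-norm, i.e. over the non-degenerate involutive representations of
`L¹(G)`. The norm of the group C⋆-algebra `C⋆(G)` is the supremum of this set. -/
def groupCStarNorms {μ : Measure G} [μ.IsHaarMeasure] (f : ConvAlg 𝕜 G μ) : Set ℝ :=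
  {c | ∃ (X : HilbertSpace.{w, v} 𝕜) (π : ConvAlg 𝕜 G μ →⋆ₙₐ[𝕜] (X →L[𝕜] X)),
    IsNondegenerate π ∧ (∀ g, ‖π g‖ ≤ g.l1norm) ∧ ‖π f‖ = c}

end Predicates

end GroupCrossed

open GroupCrossed MeasureTheory

/-!
A continuous function from `G` to a Banach space takes values in a closed subspace if and only if
all its integrals against `C_c(G)` do. Together with the density of `q` this identifies invariant
subspaces and intertwiners for `U`, for its integrated form and for `U^𝓡`; a unitary
representation is determined by its integrated form because the identity is an intertwiner.

Conversely, let `T` be a non-degenerate representation of the crossed product. It is contractive: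
`‖S‖²` is an approximate eigenvalue of `S*S`, for real scalars too, and spectral values are bounded
by the norm. Hence `π = T ∘ q` is bounded by the `L¹`-norm. Since `(λ_s f)* * λ_s g = f* * g`, the
maps `π f x ↦ π (λ_s f) x` preserve inner products and extend to isometries `U_s`, and `s ↦ U_s` is
strongly continuous because translation is continuous in `L¹`. Finally `f * g` is the integral of
the functions `f(r) λ_r g` in the supremum norm on a fixed compact set, which there dominates a
multiple of the `L¹`-norm, so that `π (f * g) = ∫ f(r) U_r π(g) dr`: the integrated form of `U`
is `π`.
-/

namespace GroupCrossed

open Measure Set Topology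
open scoped Pointwise

section Contractive

variable {𝕜 : Type*} [RCLike 𝕜] {H : Type*} [NormedAddCommGroup H] [InnerProductSpace 𝕜 H]
  [CompleteSpace H]

theorem norm_smul_sub_star_mul_self_apply_sq_le (S : H →L[𝕜] H) (x : H) :
    ‖((‖S‖ ^ 2 : ℝ) : 𝕜) • x - (star S * S) x‖ ^ 2 ≤
      ‖S‖ ^ 2 * (‖S‖ ^ 2 * ‖x‖ ^ 2 - ‖S x‖ ^ 2) := by
  have hinner : RCLike.re (inner 𝕜 (((‖S‖ ^ 2 : ℝ) : 𝕜) • x) ((star S * S) x)) =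
      ‖S‖ ^ 2 * ‖S x‖ ^ 2 := by
    rw [inner_smul_left, RCLike.conj_ofReal, mul_apply_eq_comp,
      ContinuousLinearMap.star_eq_adjoint, ContinuousLinearMap.adjoint_inner_right,
      RCLike.re_ofReal_mul, ← norm_sq_eq_re_inner]
  have hstar : ‖(star S * S) x‖ ≤ ‖S‖ * ‖S x‖ :=
    ((star S).le_opNorm (S x)).trans_eq (by
      rw [ContinuousLinearMap.star_eq_adjoint, LinearIsometryEquiv.norm_map])
  have hstar_sq : ‖(star S * S) x‖ ^ 2 ≤ ‖S‖ ^ 2 * ‖S x‖ ^ 2 := by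
    rw [← mul_pow]
    gcongr
  rw [norm_sub_sq (𝕜 := 𝕜), hinner, norm_smul, RCLike.norm_ofReal, abs_of_nonneg (sq_nonneg ‖S‖)]
  linarith

theorem exists_norm_le_mul_norm_smul_sub_of_notMem_spectrum {E : Type*} [NormedAddCommGroup E]
    [NormedSpace 𝕜 E] {T : E →L[𝕜] E} {k : 𝕜} (hk : k ∉ spectrum 𝕜 T) :
    ∃ C > 0, ∀ x, ‖x‖ ≤ C * ‖k • x - T x‖ := by
  obtain ⟨u, hu⟩ := spectrum.notMem_iff.1 hk
  let R : E →L[𝕜] E := ↑u⁻¹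
  refine ⟨‖R‖ + 1, by positivity, fun x => ?_⟩
  have hR : R (k • x - T x) = x := by
    have h := DFunLike.congr_fun u.inv_mul x
    rwa [hu, Algebra.algebraMap_eq_smul_one] at h
  calc ‖x‖ = ‖R (k • x - T x)‖ := by rw [hR]
    _ ≤ (‖R‖ + 1) * ‖k • x - T x‖ := R.le_of_opNorm_le (le_add_of_nonneg_right zero_le_one) _

theorem norm_sq_mem_spectrum_star_mul_self {S : H →L[𝕜] H} (hS : S ≠ 0) :
    ((‖S‖ ^ 2 : ℝ) : 𝕜) ∈ spectrum 𝕜 (star S * S) := by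
  by_contra hmem
  have hS_pos : 0 < ‖S‖ := norm_pos_iff.2 hS
  obtain ⟨C, hC, hle⟩ := exists_norm_le_mul_norm_smul_sub_of_notMem_spectrum hmem
  have hsq : ∀ x, ‖x‖ ^ 2 ≤ C ^ 2 * (‖S‖ ^ 2 * (‖S‖ ^ 2 * ‖x‖ ^ 2 - ‖S x‖ ^ 2)) := fun x =>
    calc ‖x‖ ^ 2 ≤ _ := pow_le_pow_left₀ (norm_nonneg x) (hle x) 2
      _ ≤ _ := by
        rw [mul_pow]
        gcongr
        exact norm_smul_sub_star_mul_self_apply_sq_le S x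
  set δ : ℝ := (C ^ 2 * ‖S‖ ^ 2)⁻¹ with hδ
  have hδ_pos : 0 < δ := by positivity
  have hbound : ∀ x, ‖S x‖ ≤ √(‖S‖ ^ 2 - δ) * ‖x‖ := fun x => by
    have h : δ * ‖x‖ ^ 2 ≤ ‖S‖ ^ 2 * ‖x‖ ^ 2 - ‖S x‖ ^ 2 := by
      rw [hδ, inv_mul_le_iff₀ (by positivity), mul_assoc]
      exact hsq x
    rw [← Real.sqrt_sq (norm_nonneg x), ← Real.sqrt_mul' _ (sq_nonneg _)]
    exact Real.le_sqrt_of_sq_le (by linarith)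
  refine lt_irrefl ‖S‖ ((S.opNorm_le_bound (Real.sqrt_nonneg _) hbound).trans_lt ?_)
  exact (Real.sqrt_lt' hS_pos).2 (by linarith)

variable {A : Type*} [NonUnitalNormedRing A] [CompleteSpace A] [NormedSpace 𝕜 A]
  [IsScalarTower 𝕜 A A] [SMulCommClass 𝕜 A A]

theorem norm_le_of_mem_quasispectrum {a : A} {k : 𝕜} (hk : k ∈ quasispectrum 𝕜 a) :
    ‖k‖ ≤ ‖a‖ := by
  rw [Unitization.quasispectrum_eq_spectrum_inr' 𝕜 𝕜,
    ← AlgEquiv.spectrum_eq (WithLp.unitizationAlgEquiv 𝕜).symm (a : Unitization 𝕜 A)] at hk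
  refine (spectrum.norm_le_norm_mul_of_mem hk).trans_eq ?_
  have hone : ‖(1 : WithLp 1 (Unitization 𝕜 A))‖ = 1 := by
    rw [WithLp.unitization_norm_def]
    change ‖(1 : 𝕜)‖ + ‖(0 : A)‖ = 1
    rw [norm_one, norm_zero, add_zero]
  rw [hone, mul_one]
  exact WithLp.unitization_norm_inr a

theorem norm_starHom_le [StarRing A] [NormedStarGroup A] (T : A →⋆ₙₐ[𝕜] (H →L[𝕜] H)) (a : A) :
    ‖T a‖ ≤ ‖a‖ := by
  rcases eq_or_ne (T a) 0 with hTa | hTa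
  · simp [hTa]
  have hmem : ((‖T a‖ ^ 2 : ℝ) : 𝕜) ∈ quasispectrum 𝕜 (star a * a) := by
    refine NonUnitalAlgHom.quasispectrum_apply_subset T _ (spectrum_subset_quasispectrum 𝕜 _ ?_)
    rw [map_mul, map_star]
    exact norm_sq_mem_spectrum_star_mul_self hTa
  refine le_of_sq_le_sq ?_ (norm_nonneg a)
  calc ‖T a‖ ^ 2 = ‖((‖T a‖ ^ 2 : ℝ) : 𝕜)‖ := by simp
    _ ≤ ‖star a * a‖ := norm_le_of_mem_quasispectrum hmem
    _ ≤ ‖a‖ ^ 2 := (norm_mul_le _ _).trans_eq (by rw [norm_star, sq])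

end Contractive

section DenseFamilies

variable {𝕜 : Type w} [RCLike 𝕜] {ι κ : Type*} [TopologicalSpace κ] {X Y : HilbertSpace.{w, v} 𝕜}
  {e : ι → κ}

theorem closedInvariantSubspaces_comp_denseRange (he : DenseRange e) {S : κ → (X →L[𝕜] X)}
    (hS : Continuous S) :
    closedInvariantSubspaces (fun i => S (e i)) = closedInvariantSubspaces S := by
  ext Z
  refine and_congr_right fun hZ => ⟨fun h k x hx => ?_, fun h i => h (e i)⟩
  exact he.induction_on k (hZ.preimage (hS.clm_apply continuous_const)) fun i => h i x hx

theorem intertwiners_comp_denseRange (he : DenseRange e) {S : κ → (X →L[𝕜] X)}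
    {T : κ → (Y →L[𝕜] Y)} (hS : Continuous S) (hT : Continuous T) :
    intertwiners (fun i => S (e i)) (fun i => T (e i)) = intertwiners S T := by
  ext Φ
  refine ⟨fun h k => ?_, fun h i => h (e i)⟩
  exact he.induction_on k
    (isClosed_eq (hT.clm_comp continuous_const) (continuous_const.clm_comp hS)) h

theorem isNondegenerate_comp_iff {A B : Type*} [NonUnitalNonAssocSemiring A]
    [DistribMulAction 𝕜 A] [Star A] [NonUnitalNonAssocSemiring B] [DistribMulAction 𝕜 B] [Star B]
    [TopologicalSpace B] {e : A →⋆ₙₐ[𝕜] B} (he : DenseRange e) {T : B →⋆ₙₐ[𝕜] (X →L[𝕜] X)}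
    (hT : Continuous T) : IsNondegenerate (T.comp e) ↔ IsNondegenerate T := by
  refine ⟨fun h => h.mono (Submodule.span_mono ?_), fun h => ?_⟩
  · rintro _ ⟨a, x, rfl⟩
    exact ⟨e a, x, rfl⟩
  · rw [IsNondegenerate, ← dense_closure]
    refine h.mono (Submodule.span_le (p := Submodule.topologicalClosure _).2 ?_)
    rintro _ ⟨b, x, rfl⟩
    exact he.induction_on b
      ((Submodule.isClosed_topologicalClosure _).preimage (hT.clm_apply continuous_const))
      fun a => Submodule.le_topologicalClosure _ (Submodule.subset_span ⟨a, x, rfl⟩)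

theorem IsNondegenerate.hom_ext {A : Type*} [NonUnitalNonAssocSemiring A] [DistribMulAction 𝕜 A]
    [Star A] {π : A →⋆ₙₐ[𝕜] (X →L[𝕜] X)} (h : IsNondegenerate π) {F : Type*} [FunLike F X X]
    [ContinuousLinearMapClass F 𝕜 X X] {S T : F} (hST : ∀ a x, S (π a x) = T (π a x)) : S = T := by
  have heq : EqOn S T {y | ∃ a x, π a x = y} := by
    rintro _ ⟨a, x, rfl⟩
    exact hST a x
  exact DFunLike.coe_injective <| Continuous.ext_on h (map_continuous S) (map_continuous T)
    (LinearMap.eqOn_span (f := (S : X →ₗ[𝕜] X)) (g := (T : X →ₗ[𝕜] X)) heq)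

end DenseFamilies

section Testing

theorem mem_iff_forall_dual_eq_zero {𝕜 E : Type*} [RCLike 𝕜] [NormedAddCommGroup E]
    [NormedSpace 𝕜 E] {Z : Submodule 𝕜 E} (hZ : IsClosed (Z : Set E)) {x : E} :
    x ∈ Z ↔ ∀ φ : StrongDual 𝕜 E, (∀ z ∈ Z, φ z = 0) → φ x = 0 := by
  refine ⟨fun hx φ hφ => hφ x hx, fun h => ?_⟩
  have : IsClosed (Z : Set E) := hZ
  refine (Submodule.Quotient.mk_eq_zero Z).1
    (SeparatingDual.eq_zero_of_forall_dual_eq_zero (R := 𝕜) ?_)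
  exact fun ψ : StrongDual 𝕜 (E ⧸ Z) => h (ψ ∘L Z.mkQL) fun z hz =>
    (congrArg ψ ((Submodule.Quotient.mk_eq_zero Z).2 hz)).trans (map_zero ψ)

variable {𝕜 : Type*} [RCLike 𝕜] {G : Type*} [Group G] [TopologicalSpace G]
  [IsTopologicalGroup G] [LocallyCompactSpace G] [MeasurableSpace G] [BorelSpace G]
  (μ : Measure G) [μ.IsHaarMeasure]

theorem eq_zero_of_forall_integral_mul_eq_zero {h : G → 𝕜} (hh : Continuous h)
    (hf : ∀ f : ConvAlg 𝕜 G μ, ∫ s, f s * h s ∂μ = 0) : h = 0 := by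
  by_contra hne
  obtain ⟨s, hs⟩ := Function.ne_iff.1 hne
  obtain ⟨⟨b, hb⟩, hb_comp, hb_nonneg, hb_s⟩ :
    ∃ b : C(G, ℝ), HasCompactSupport b ∧ 0 ≤ b ∧ b s ≠ 0 := exists_continuous_nonneg_pos s
  have hb_comp' : HasCompactSupport fun t => (b t : 𝕜) :=
    hb_comp.comp_left (g := ((↑) : ℝ → 𝕜)) RCLike.ofReal_zero
  let f : ConvAlg 𝕜 G μ := ConvAlg.mk (fun t => (b t : 𝕜) * star (h t))
    ((RCLike.continuous_ofReal.comp hb).mul hh.star) hb_comp'.mul_right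
  have hfh : ∀ t, f t * h t = ((b t * ‖h t‖ ^ 2 : ℝ) : 𝕜) := fun t => by
    simp only [f, ConvAlg.mk_apply, RCLike.star_def, mul_assoc, RCLike.conj_mul]
    norm_cast
  have hpos : 0 < ∫ t, b t * ‖h t‖ ^ 2 ∂μ :=
    (hb.mul (hh.norm.pow 2)).integral_pos_of_hasCompactSupport_nonneg_nonzero
      (HasCompactSupport.mul_right hb_comp) (fun t => mul_nonneg (hb_nonneg t) (sq_nonneg _))
      (mul_ne_zero hb_s (pow_ne_zero _ (norm_ne_zero_iff.2 hs)))
  refine hpos.ne' ((RCLike.ofReal_eq_zero (K := 𝕜)).1 ?_)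
  rw [← integral_ofReal, ← hf f]
  simp only [hfh]

theorem forall_integral_smul_mem_iff {E : Type*} [NormedAddCommGroup E] [NormedSpace ℝ E]
    [NormedSpace 𝕜 E] [CompleteSpace E] {Z : Submodule 𝕜 E} (hZ : IsClosed (Z : Set E))
    {h : G → E} (hh : Continuous h) :
    (∀ f : ConvAlg 𝕜 G μ, ∫ s, f s • h s ∂μ ∈ Z) ↔ ∀ s, h s ∈ Z := by
  have hφ : ∀ (φ : StrongDual 𝕜 E) (f : ConvAlg 𝕜 G μ),
      φ (∫ s, f s • h s ∂μ) = ∫ s, f s * φ (h s) ∂μ := fun φ f => by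
    rw [← φ.integral_comp_comm (f.integrable_smul hh)]
    simp only [map_smul, smul_eq_mul]
  refine ⟨fun H s => (mem_iff_forall_dual_eq_zero hZ).2 fun φ hφZ => ?_,
    fun H f => (mem_iff_forall_dual_eq_zero hZ).2 fun φ hφZ => ?_⟩
  · exact congrFun (eq_zero_of_forall_integral_mul_eq_zero μ (φ.continuous.comp hh) fun f =>
      (hφ φ f).symm.trans (hφZ _ (H f))) s
  · simp only [hφ, hφZ _ (H _), mul_zero, integral_zero]

end Testing

section Extension

variable {𝕜 : Type*} [RCLike 𝕜]

theorem exists_linearIsometry_of_inner_eq {ι E F : Type*} [NormedAddCommGroup E]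
    [InnerProductSpace 𝕜 E] [NormedAddCommGroup F] [InnerProductSpace 𝕜 F] [CompleteSpace F]
    {v : ι → E} {w : ι → F} (hv : Dense (Submodule.span 𝕜 (range v) : Set E))
    (hvw : ∀ i j, inner 𝕜 (w i) (w j) = inner 𝕜 (v i) (v j)) :
    ∃ L : E →ₗᵢ[𝕜] F, ∀ i, L (v i) = w i := by
  let lv := Finsupp.linearCombination 𝕜 v
  let lw := Finsupp.linearCombination 𝕜 w
  have hnorm : ∀ a, ‖lw a‖ = ‖lv a‖ := fun a => by
    rw [@norm_eq_sqrt_re_inner 𝕜, @norm_eq_sqrt_re_inner 𝕜]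
    simp only [lv, lw, Finsupp.linearCombination_apply, Finsupp.sum_inner, Finsupp.inner_sum, hvw,
      inner_smul_left, inner_smul_right]
  have hdense : DenseRange lv := by
    rwa [← Finsupp.range_linearCombination, LinearMap.coe_range] at hv
  let L : E →L[𝕜] F := lw.extendOfNorm lv
  have hL : ∀ a, L (lv a) = lw a :=
    LinearMap.extendOfNorm_eq hdense ⟨1, fun a => by rw [one_mul, hnorm]⟩
  refine ⟨⟨L, fun x => ?_⟩, fun i => ?_⟩
  · exact hdense.induction_on x (isClosed_eq L.continuous.norm continuous_norm) fun a =>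
      (congrArg norm (hL a)).trans (hnorm a)
  · have h := hL (Finsupp.single i 1)
    simp only [lv, lw, Finsupp.linearCombination_single, one_smul] at h
    exact h

theorem isClosed_setOf_continuous_linearIsometry_apply {α E F : Type*} [TopologicalSpace α]
    [NormedAddCommGroup E] [NormedSpace 𝕜 E] [NormedAddCommGroup F] [NormedSpace 𝕜 F]
    (L : α → E →ₗᵢ[𝕜] F) : IsClosed {x | Continuous fun s => L s x} := by
  refine isClosed_of_closure_subset fun x hx => ?_
  refine continuous_of_uniform_approx_of_continuous fun V hV => ?_
  obtain ⟨ε, hε, hV⟩ := Metric.mem_uniformity_dist.1 hV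
  obtain ⟨y, hy, hxy⟩ := Metric.mem_closure_iff.1 hx ε hε
  exact ⟨_, hy, fun s => hV (((L s).isometry.dist_eq x y).trans_lt hxy)⟩

theorem map_eq_integral_of_norm_le {α V E F : Type*} [MeasurableSpace α] {μ : Measure α}
    [AddCommGroup V] [Module 𝕜 V] [NormedAddCommGroup E] [NormedSpace ℝ E] [NormedSpace 𝕜 E]
    [CompleteSpace E] [NormedAddCommGroup F] [NormedSpace ℝ F] [NormedSpace 𝕜 F] [CompleteSpace F]
    {e : V →ₗ[𝕜] E} {T : V →ₗ[𝕜] F} {C : ℝ} (hT : ∀ v, ‖T v‖ ≤ C * ‖e v‖) {u : α → V}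
    (hu : Integrable (fun r => e (u r)) μ) (hTu : Integrable (fun r => T (u r)) μ) {v : V}
    (hv : e v = ∫ r, e (u r) ∂μ) : T v = ∫ r, T (u r) ∂μ := by
  refine (SeparatingDual.eq_iff_forall_dual_eq (R := 𝕜)).2 fun φ => ?_
  let g : StrongDual 𝕜 (LinearMap.range e) := (φ.toLinearMap ∘ₗ T).extendOfNorm e.rangeRestrict
  have hg : ∀ v, g (e.rangeRestrict v) = φ (T v) :=
    LinearMap.extendOfNorm_eq e.surjective_rangeRestrict.denseRange
      ⟨‖φ‖ * C, fun v => (φ.le_opNorm_of_le (hT v)).trans_eq (mul_assoc _ _ _).symm⟩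
  obtain ⟨ψ, hψ, -⟩ := exists_extension_norm_eq _ g
  have hψ_e : ∀ v, ψ (e v) = φ (T v) := fun v => (hψ (e.rangeRestrict v)).trans (hg v)
  rw [← φ.integral_comp_comm hTu, ← hψ_e, hv, ← ψ.integral_comp_comm hu]
  simp only [hψ_e]

end Extension

namespace ConvAlg

variable {𝕜 : Type*} [RCLike 𝕜] {G : Type*} [TopologicalSpace G] [MeasurableSpace G]
  {μ : Measure G}

section Support

/-- The functions in `C_c(G)` that vanish outside `K`. -/
def supportedIn (K : Set G) : Submodule 𝕜 (ConvAlg 𝕜 G μ) where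
  carrier := {h | ∀ s ∉ K, h s = 0}
  zero_mem' _ _ := rfl
  add_mem' ha hb s hs := by rw [add_apply, ha s hs, hb s hs, add_zero]
  smul_mem' c _ ha s hs := by rw [smul_apply, ha s hs, mul_zero]

/-- Restriction of functions supported in `K` to `K`, where the supremum norm is available. -/
def restrict (K : Set G) : supportedIn (μ := μ) (𝕜 := 𝕜) K →ₗ[𝕜] C(K, 𝕜) where
  toFun h := ⟨fun s => h.1 s, by fun_prop⟩
  map_add' _ _ := rfl
  map_smul' _ _ := rfl

theorem l1norm_le_norm_restrict [IsFiniteMeasureOnCompacts μ] {K : Set G} [CompactSpace K]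
    (h : supportedIn (μ := μ) (𝕜 := 𝕜) K) : h.1.l1norm ≤ μ.real K * ‖restrict K h‖ := by
  have hK : IsCompact K := isCompact_iff_compactSpace.2 ‹_›
  have hnonneg : 0 ≤ h.1.l1norm := integral_nonneg fun _ => norm_nonneg _
  rw [← abs_of_nonneg hnonneg, ← Real.norm_eq_abs, l1norm,
    ← setIntegral_eq_integral_of_forall_compl_eq_zero (s := K) fun s hs => by
      rw [h.2 s hs, norm_zero], mul_comm]
  refine norm_setIntegral_le_of_norm_le_const hK.measure_lt_top fun s hs => ?_
  rw [norm_norm]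
  exact (restrict K h).norm_coe_le_norm ⟨s, hs⟩

end Support

variable [Group G] [IsTopologicalGroup G]

/-- Left translation `(λ_s f) r = f (s⁻¹ * r)` on `C_c(G)`. -/
def translate (s : G) : ConvAlg 𝕜 G μ →ₗ[𝕜] ConvAlg 𝕜 G μ where
  toFun f := mk (fun r => f (s⁻¹ * r)) (by fun_prop)
    (f.hasCompactSupport.comp_homeomorph (Homeomorph.mulLeft s⁻¹))
  map_add' _ _ := rfl
  map_smul' _ _ := rfl

@[simp] theorem translate_apply (s : G) (f : ConvAlg 𝕜 G μ) (r : G) :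
    translate s f r = f (s⁻¹ * r) := rfl

theorem translate_one (f : ConvAlg 𝕜 G μ) : translate 1 f = f := by
  ext r
  simp

theorem translate_mul (s t : G) (f : ConvAlg 𝕜 G μ) :
    translate (s * t) f = translate s (translate t f) := by
  ext r
  simp [mul_assoc]

theorem smul_translate_mem_supportedIn (f g : ConvAlg 𝕜 G μ) (r : G) :
    f r • translate r g ∈ supportedIn (tsupport f * tsupport g) := by
  intro s hs
  by_contra h
  exact hs ⟨r, subset_tsupport f (left_ne_zero_of_mul h), r⁻¹ * s,
    subset_tsupport g (right_ne_zero_of_mul h), mul_inv_cancel_left r s⟩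

variable [LocallyCompactSpace G] [BorelSpace G] [μ.IsHaarMeasure]

theorem mul_mem_supportedIn (f g : ConvAlg 𝕜 G μ) :
    f * g ∈ supportedIn (tsupport f * tsupport g) := fun s hs =>
  integral_eq_zero_of_ae (.of_forall fun r => smul_translate_mem_supportedIn f g r s hs)

theorem star_mul_apply (f g : ConvAlg 𝕜 G μ) (t : G) :
    (star f * g) t = ∫ r, star (f r) * g (r * t) ∂μ := by
  rw [mul_apply, ← integral_modularFunction_inv μ (f := fun r => star (f r) * g (r * t))
    (by fun_prop) (HasCompactSupport.mul_right (f.hasCompactSupport.comp_left (star_zero 𝕜)))]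
  simp only [star_apply, mul_assoc, RCLike.real_smul_eq_coe_mul]

theorem star_translate_mul_translate (s : G) (f g : ConvAlg 𝕜 G μ) :
    star (translate s f) * translate s g = star f * g := by
  ext t
  rw [star_mul_apply, star_mul_apply,
    ← integral_mul_left_eq_self (fun r => star (f r) * g (r * t)) s⁻¹]
  simp only [translate_apply, mul_assoc]

theorem continuous_l1norm_translate_sub (f : ConvAlg 𝕜 G μ) (t : G) :
    Continuous fun s => (translate s f - translate t f).l1norm := by
  refine continuous_iff_continuousAt.2 fun s₀ => ?_
  obtain ⟨K, hK, hs₀⟩ := exists_compact_mem_nhds s₀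
  refine ContinuousOn.continuousAt (s := K) ?_ hs₀
  refine continuousOn_integral_of_compact_support (k := insert t K * tsupport f)
    ((hK.insert t).mul f.hasCompactSupport.isCompact) ?_ fun s r hs hr => ?_
  · have : Continuous fun p : G × G => ‖f (p.1⁻¹ * p.2) - f (t⁻¹ * p.2)‖ := by fun_prop
    exact this.continuousOn
  · have hzero : ∀ a ∈ insert t K, f (a⁻¹ * r) = 0 := fun a ha => by
      by_contra hne
      exact hr ⟨a, ha, _, subset_tsupport _ hne, mul_inv_cancel_left a r⟩
    change ‖f (s⁻¹ * r) - f (t⁻¹ * r)‖ = 0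
    rw [hzero s (mem_insert_of_mem _ hs), hzero t (mem_insert _ _), sub_zero, norm_zero]

section BoundedMap

variable {F : Type*} [NormedAddCommGroup F] [NormedSpace 𝕜 F] {T : ConvAlg 𝕜 G μ →ₗ[𝕜] F} {C : ℝ}

theorem continuous_map_translate (hT : ∀ h, ‖T h‖ ≤ C * h.l1norm) (f : ConvAlg 𝕜 G μ) :
    Continuous fun s => T (translate s f) := by
  refine continuous_iff_continuousAt.2 fun t => tendsto_iff_norm_sub_tendsto_zero.2 ?_
  have h : Filter.Tendsto (fun s => C * (translate s f - translate t f).l1norm) (𝓝 t) (𝓝 0) := by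
    refine ((continuous_l1norm_translate_sub f t).const_mul C).tendsto' t 0 ?_
    simp only [sub_self, l1norm, zero_apply, norm_zero, integral_zero, mul_zero]
  refine squeeze_zero (fun _ => norm_nonneg _) (fun s => ?_) h
  rw [← map_sub]
  exact hT _

theorem map_mul_eq_integral [NormedSpace ℝ F] [CompleteSpace F]
    (hT : ∀ h, ‖T h‖ ≤ C * h.l1norm) (hC : 0 ≤ C) (f g : ConvAlg 𝕜 G μ) :
    T (f * g) = ∫ r, f r • T (translate r g) ∂μ := by
  let K := tsupport f * tsupport g
  have hK : CompactSpace K := isCompact_iff_compactSpace.1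
    (f.hasCompactSupport.isCompact.mul g.hasCompactSupport.isCompact)
  let u : G → supportedIn K := fun r => ⟨f r • translate r g, smul_translate_mem_supportedIn f g r⟩
  have hu : Integrable (fun r => restrict K (u r)) μ := by
    refine Continuous.integrable_of_hasCompactSupport ?_
      (HasCompactSupport.intro f.hasCompactSupport.isCompact fun r hr => ?_)
    · refine ContinuousMap.continuous_of_continuous_uncurry _ ?_
      change Continuous fun p : G × K => f p.1 * g (p.1⁻¹ * p.2)
      fun_prop
    · ext s
      exact mul_eq_zero_of_left (image_eq_zero_of_notMem_tsupport hr) _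
  have hTu : Integrable (fun r => T (u r).1) μ := by
    simpa only [u, map_smul] using f.integrable_smul (continuous_map_translate hT g)
  have hbound : ∀ h : supportedIn K, ‖T h.1‖ ≤ C * μ.real K * ‖restrict K h‖ := fun h =>
    (hT h.1).trans ((mul_le_mul_of_nonneg_left (l1norm_le_norm_restrict h) hC).trans_eq
      (mul_assoc _ _ _).symm)
  have hfg : restrict K ⟨f * g, mul_mem_supportedIn f g⟩ = ∫ r, restrict K (u r) ∂μ := by
    ext s
    rw [ContinuousMap.integral_apply hu]
    rfl
  have h := map_eq_integral_of_norm_le (T := T ∘ₗ (supportedIn K).subtype) hbound hu hTu hfg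
  simpa only [u, LinearMap.comp_apply, Submodule.subtype_apply, map_smul] using h

end BoundedMap

end ConvAlg

variable {𝕜 : Type w} [RCLike 𝕜] {G : Type u} [Group G] [TopologicalSpace G]
  [IsTopologicalGroup G] [LocallyCompactSpace G] [MeasurableSpace G] [BorelSpace G]

namespace UnitaryRep

variable (μ : Measure G) [μ.IsHaarMeasure] {X Y : HilbertSpace.{w, v} 𝕜}

theorem isNondegenerate_integratedForm (U : UnitaryRep G X) :
    IsNondegenerate (U.integratedForm (μ := μ)) := by
  rw [IsNondegenerate, Submodule.dense_iff_topologicalClosure_eq_top, Submodule.eq_top_iff']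
  intro x
  have hU := (forall_integral_smul_mem_iff μ (Submodule.isClosed_topologicalClosure
    (Submodule.span 𝕜 {y : X | ∃ (f : ConvAlg 𝕜 G μ) (x : X), U.integratedForm f x = y}))
    (U.continuous_apply x)).1 fun f =>
      Submodule.le_topologicalClosure _ (Submodule.subset_span ⟨f, x, U.integratedForm_apply f x⟩)
  simpa only [map_one, one_apply_eq_self] using hU 1

theorem closedInvariantSubspaces_integratedForm (U : UnitaryRep G X) :
    closedInvariantSubspaces (fun f : ConvAlg 𝕜 G μ => U.integratedForm f) =
      closedInvariantSubspaces (fun s : G => U s) := by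
  ext Z
  refine and_congr_right fun hZ => ?_
  have h := fun x => forall_integral_smul_mem_iff μ hZ (U.continuous_apply x)
  exact ⟨fun H s x hx => (h x).1 (fun f => H f x hx) s,
    fun H f x hx => (h x).2 (fun s => H s x hx) f⟩

theorem intertwiners_integratedForm (U : UnitaryRep G X) (V : UnitaryRep G Y) :
    intertwiners (fun f : ConvAlg 𝕜 G μ => U.integratedForm f)
        (fun f : ConvAlg 𝕜 G μ => V.integratedForm f) =
      intertwiners (fun s : G => U s) (fun s : G => V s) := by
  ext Φ
  let d : X → G → Y := fun x s => V s (Φ x) - Φ (U s x)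
  have hd : ∀ x, Continuous (d x) := fun x =>
    (V.continuous_apply _).sub (Φ.continuous.comp (U.continuous_apply x))
  have hint : ∀ (f : ConvAlg 𝕜 G μ) x,
      V.integratedForm f (Φ x) - Φ (U.integratedForm f x) = ∫ s, f s • d x s ∂μ := fun f x => by
    have hU := f.integrable_smul (U.continuous_apply x)
    rw [integratedForm_apply, integratedForm_apply, ← Φ.integral_comp_comm hU,
      ← integral_sub (f.integrable_smul (V.continuous_apply _)) (Φ.integrable_comp hU)]
    simp only [d, map_smul, smul_sub]
  have h := fun x => forall_integral_smul_mem_iff μ (𝕜 := 𝕜) (Z := ⊥) isClosed_singleton (hd x)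
  simp only [Submodule.mem_bot, ← hint, d, sub_eq_zero] at h
  change (∀ f : ConvAlg 𝕜 G μ, V.integratedForm f ∘L Φ = Φ ∘L U.integratedForm f) ↔
    ∀ s, V s ∘L Φ = Φ ∘L U s
  simp only [ContinuousLinearMap.ext_iff, ContinuousLinearMap.comp_apply]
  rw [forall_comm, forall_comm (α := G)]
  exact forall_congr' h

theorem integratedForm_injective :
    Function.Injective fun U : UnitaryRep G X => U.integratedForm (μ := μ) := by
  intro U V hUV
  have hid : ContinuousLinearMap.id 𝕜 X ∈ intertwiners (fun s => U s) fun s => V s := by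
    rw [← intertwiners_integratedForm μ]
    exact fun f => (DFunLike.congr_fun hUV f).symm
  ext s x
  exact (DFunLike.congr_fun (hid s) x).symm

end UnitaryRep

namespace CrossedProduct

variable {μ : Measure G} [μ.IsHaarMeasure] {𝓗 : Set (HilbertSpace.{w, v} 𝕜)}
  {X : HilbertSpace.{w, v} 𝕜}

theorem sigma_le_l1norm (f : ConvAlg 𝕜 G μ) : sigma μ 𝓗 f ≤ f.l1norm :=
  Real.iSup_le (fun U => U.2.norm_integratedForm_le f) (integral_nonneg fun _ => norm_nonneg _)

theorem continuous_starHom (T : CrossedProduct μ 𝓗 →⋆ₙₐ[𝕜] (X →L[𝕜] X)) : Continuous T :=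
  AddMonoidHomClass.continuous_of_bound T 1 fun a => by
    rw [one_mul]
    exact norm_starHom_le T a

theorem norm_starHom_comp_q_le (T : CrossedProduct μ 𝓗 →⋆ₙₐ[𝕜] (X →L[𝕜] X))
    (f : ConvAlg 𝕜 G μ) : ‖T.comp (q μ 𝓗) f‖ ≤ f.l1norm :=
  (norm_starHom_le T _).trans ((norm_q f).trans_le (sigma_le_l1norm f))

theorem starHom_ext {S T : CrossedProduct μ 𝓗 →⋆ₙₐ[𝕜] (X →L[𝕜] X)}
    (h : S.comp (q μ 𝓗) = T.comp (q μ 𝓗)) : S = T :=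
  DFunLike.coe_injective (denseRange_q.equalizer (continuous_starHom S) (continuous_starHom T)
    (funext fun f => DFunLike.congr_fun h f))

end CrossedProduct

section CrossedRep

variable (μ : Measure G) [μ.IsHaarMeasure] {𝓗 : Set (HilbertSpace.{w, v} 𝕜)} {X Y : 𝓗}

theorem UnitaryRep.crossedRep_comp_q (U : UnitaryRep G X.1) :
    U.crossedRep.comp (CrossedProduct.q μ 𝓗) = U.integratedForm :=
  DFunLike.ext _ _ U.crossedRep_q

theorem UnitaryRep.closedInvariantSubspaces_crossedRep (U : UnitaryRep G X.1) :
    closedInvariantSubspaces (fun a : CrossedProduct μ 𝓗 => U.crossedRep a) =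
      closedInvariantSubspaces (fun s : G => U s) := by
  rw [← U.closedInvariantSubspaces_integratedForm μ, ← closedInvariantSubspaces_comp_denseRange
    CrossedProduct.denseRange_q (CrossedProduct.continuous_starHom _)]
  simp only [crossedRep_q]

theorem UnitaryRep.intertwiners_crossedRep (U : UnitaryRep G X.1) (V : UnitaryRep G Y.1) :
    intertwiners (fun a : CrossedProduct μ 𝓗 => U.crossedRep a)
        (fun a : CrossedProduct μ 𝓗 => V.crossedRep a) =
      intertwiners (fun s : G => U s) (fun s : G => V s) := by
  rw [← U.intertwiners_integratedForm μ, ← intertwiners_comp_denseRange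
    CrossedProduct.denseRange_q (CrossedProduct.continuous_starHom _)
    (CrossedProduct.continuous_starHom _)]
  simp only [crossedRep_q]

end CrossedRep

/-- A strongly continuous homomorphism from a group to the isometries of a Hilbert space, viewed as
a unitary representation: its values are invertible, hence unitary. -/
noncomputable def UnitaryRep.ofLinearIsometry {X : HilbertSpace.{w, v} 𝕜} (ρ : G →* (X →ₗᵢ[𝕜] X))
    (hρ : ∀ x, Continuous fun s => ρ s x) : UnitaryRep G X where
  toHom :=
    let σ : G →* (X →L[𝕜] X) :=
      { toFun s := (ρ s).toContinuousLinearMap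
        map_one' := by rw [_root_.map_one]; rfl
        map_mul' s t := by rw [_root_.map_mul]; rfl }
    σ.codRestrict (unitary (X →L[𝕜] X)) fun s =>
      ((Group.isUnit s).map σ).mem_unitary_of_star_mul_self
        ((ContinuousLinearMap.norm_map_iff_adjoint_comp_self _).1 (ρ s).norm_map)
  continuous_apply' := hρ

theorem inner_starHom_apply_starHom_apply {A H : Type*} [NonUnitalNonAssocSemiring A]
    [DistribMulAction 𝕜 A] [Star A] [NormedAddCommGroup H] [InnerProductSpace 𝕜 H]
    [CompleteSpace H] (π : A →⋆ₙₐ[𝕜] (H →L[𝕜] H)) (a b : A) (x y : H) :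
    inner 𝕜 (π a x) (π b y) = inner 𝕜 x (π (star a * b) y) := by
  rw [map_mul, map_star, mul_apply_eq_comp, ContinuousLinearMap.star_eq_adjoint,
    ContinuousLinearMap.adjoint_inner_right]

variable {μ : Measure G} [μ.IsHaarMeasure] {X : HilbertSpace.{w, v} 𝕜}
  {π : ConvAlg 𝕜 G μ →⋆ₙₐ[𝕜] (X →L[𝕜] X)}

theorem continuous_starHom_translate (hπ : ∀ f, ‖π f‖ ≤ f.l1norm) (f : ConvAlg 𝕜 G μ) :
    Continuous fun s => π (ConvAlg.translate s f) :=
  ConvAlg.continuous_map_translate (T := (π : ConvAlg 𝕜 G μ →ₗ[𝕜] (X →L[𝕜] X))) (C := 1)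
    (fun h => by rw [one_mul]; exact hπ h) f

theorem starHom_mul_apply_eq_integral (hπ : ∀ f, ‖π f‖ ≤ f.l1norm) (f g : ConvAlg 𝕜 G μ) (x : X) :
    π (f * g) x = ∫ r, f r • π (ConvAlg.translate r g) x ∂μ := by
  refine ConvAlg.map_mul_eq_integral (C := ‖x‖)
    (T := (ContinuousLinearMap.apply 𝕜 X x).toLinearMap ∘ₗ (π : ConvAlg 𝕜 G μ →ₗ[𝕜] (X →L[𝕜] X)))
    (fun h => ?_) (norm_nonneg x) f g
  rw [mul_comm]
  exact (π h).le_of_opNorm_le (hπ h) x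

namespace IsNondegenerate

theorem exists_translation (h : IsNondegenerate π) (s : G) :
    ∃ L : X →ₗᵢ[𝕜] X, ∀ f x, L (π f x) = π (ConvAlg.translate s f) x := by
  have hrange : {y | ∃ f x, π f x = y} = range fun p : ConvAlg 𝕜 G μ × X => π p.1 p.2 :=
    Set.ext fun y => by simp only [mem_ofPred_eq, mem_range, Prod.exists]
  obtain ⟨L, hL⟩ := exists_linearIsometry_of_inner_eq (𝕜 := 𝕜)
    (v := fun p : ConvAlg 𝕜 G μ × X => π p.1 p.2)
    (w := fun p => π (ConvAlg.translate s p.1) p.2) (hrange ▸ h) fun p p' => by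
      simp only [inner_starHom_apply_starHom_apply, ConvAlg.star_translate_mul_translate]
  exact ⟨L, fun f x => hL (f, x)⟩

/-- The isometric representation of `G` given by `π f x ↦ π (λ_s f) x`. -/
noncomputable def translation (h : IsNondegenerate π) : G →* (X →ₗᵢ[𝕜] X) where
  toFun s := (h.exists_translation s).choose
  map_one' := h.hom_ext fun f x => by
    rw [(h.exists_translation 1).choose_spec, ConvAlg.translate_one, LinearIsometry.coe_one, id]
  map_mul' s t := h.hom_ext fun f x => by
    rw [LinearIsometry.coe_mul, Function.comp_apply, (h.exists_translation t).choose_spec,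
      (h.exists_translation s).choose_spec, (h.exists_translation _).choose_spec,
      ConvAlg.translate_mul]

theorem translation_apply (h : IsNondegenerate π) (s : G) (f : ConvAlg 𝕜 G μ) (x : X) :
    h.translation s (π f x) = π (ConvAlg.translate s f) x :=
  (h.exists_translation s).choose_spec f x

theorem continuous_translation_apply (h : IsNondegenerate π) (hπ : ∀ f, ‖π f‖ ≤ f.l1norm) (x : X) :
    Continuous fun s => h.translation s x := by
  have hclosed := isClosed_setOf_continuous_linearIsometry_apply fun s => h.translation s
  refine hclosed.closure_subset_iff.2 (fun y hy => ?_) (h x)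
  induction hy using Submodule.span_induction with
  | mem y hy =>
    obtain ⟨f, z, rfl⟩ := hy
    simp only [mem_ofPred_eq, h.translation_apply]
    exact (continuous_starHom_translate hπ f).clm_apply continuous_const
  | zero =>
    simp only [mem_ofPred_eq, map_zero]
    exact continuous_const
  | add y z _ _ hy hz =>
    simp only [mem_ofPred_eq, map_add]
    exact hy.add hz
  | smul c y _ hy =>
    simp only [mem_ofPred_eq, map_smul]
    exact hy.const_smul c

/-- The unitary representation `U` of `G` with `U s (π f x) = π (λ_s f) x`. -/
noncomputable def unitaryRep (h : IsNondegenerate π) (hπ : ∀ f, ‖π f‖ ≤ f.l1norm) :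
    UnitaryRep G X :=
  .ofLinearIsometry h.translation (h.continuous_translation_apply hπ)

theorem integratedForm_unitaryRep (h : IsNondegenerate π) (hπ : ∀ f, ‖π f‖ ≤ f.l1norm) :
    (h.unitaryRep hπ).integratedForm = π := by
  refine DFunLike.ext _ _ fun f => h.hom_ext fun g x => ?_
  rw [← mul_apply_eq_comp (π f), ← map_mul, starHom_mul_apply_eq_integral hπ,
    UnitaryRep.integratedForm_apply]
  exact integral_congr_ae (.of_forall fun r => congrArg (f r • ·) (h.translation_apply r g x))

end IsNondegenerate

theorem bijOn_crossedRep (μ : Measure G) [μ.IsHaarMeasure] (𝓗 : Set (HilbertSpace.{w, v} 𝕜)) :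
    BijOn
      (fun U : UnitaryReps G 𝓗 =>
        (⟨U.1, U.2.crossedRep⟩ : (X : 𝓗) × (CrossedProduct μ 𝓗 →⋆ₙₐ[𝕜] (X.1 →L[𝕜] X.1))))
      univ {T | IsNondegenerate T.2} := by
  have hcomp : ∀ {X : HilbertSpace.{w, v} 𝕜} (T : CrossedProduct μ 𝓗 →⋆ₙₐ[𝕜] (X →L[𝕜] X)),
      IsNondegenerate (T.comp (CrossedProduct.q μ 𝓗)) ↔ IsNondegenerate T := fun T =>
    isNondegenerate_comp_iff CrossedProduct.denseRange_q (CrossedProduct.continuous_starHom T)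
  refine ⟨fun U _ => ?_, ?_, ?_⟩
  · refine (hcomp U.2.crossedRep).1 ?_
    rw [U.2.crossedRep_comp_q μ]
    exact U.2.isNondegenerate_integratedForm μ
  · rintro ⟨X, U⟩ - ⟨Y, V⟩ - h
    obtain ⟨hXY, hUV⟩ := Sigma.mk.inj h
    obtain rfl : X = Y := hXY
    refine congrArg (Sigma.mk X) (UnitaryRep.integratedForm_injective μ ?_)
    change U.integratedForm = V.integratedForm
    rw [← U.crossedRep_comp_q μ (𝓗 := 𝓗), ← V.crossedRep_comp_q μ (𝓗 := 𝓗), eq_of_heq hUV]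
  · rintro ⟨X, T⟩ hT
    have hTq := (hcomp T).2 hT
    have hle := CrossedProduct.norm_starHom_comp_q_le T
    refine ⟨⟨X, hTq.unitaryRep hle⟩, mem_univ _, congrArg (Sigma.mk X) ?_⟩
    refine CrossedProduct.starHom_ext ?_
    rw [UnitaryRep.crossedRep_comp_q, hTq.integratedForm_unitaryRep hle]

theorem isLUB_groupCStarNorms (μ : Measure G) [μ.IsHaarMeasure] (f : ConvAlg 𝕜 G μ) :
    IsLUB (groupCStarNorms.{w, u, v} f)
      ‖CrossedProduct.q μ (univ : Set (HilbertSpace.{w, v} 𝕜)) f‖ := by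
  have hnorms : groupCStarNorms.{w, u, v} f = range fun U : UnitaryReps G
      (univ : Set (HilbertSpace.{w, v} 𝕜)) => ‖U.2.integratedForm f‖ := by
    ext c
    constructor
    · rintro ⟨X, π, h, hπ, rfl⟩
      exact ⟨⟨⟨X, mem_univ X⟩, h.unitaryRep hπ⟩, congrArg (‖· f‖) (h.integratedForm_unitaryRep hπ)⟩
    · rintro ⟨U, rfl⟩
      exact ⟨U.1.1, U.2.integratedForm, U.2.isNondegenerate_integratedForm μ,
        U.2.norm_integratedForm_le, rfl⟩
  have : Nonempty (UnitaryReps G (univ : Set (HilbertSpace.{w, v} 𝕜))) :=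
    ⟨⟨⟨⟨PUnit⟩, mem_univ _⟩, ⟨1, fun _ => continuous_const⟩⟩⟩
  rw [CrossedProduct.norm_q, hnorms]
  exact isLUB_ciSup (bddAbove_norm μ _ f)

end GroupCrossed

theorem theoremt_general {𝕜 : Type w} [RCLike 𝕜] {G : Type u} [Group G] [TopologicalSpace G]
    [IsTopologicalGroup G] [LocallyCompactSpace G] [MeasurableSpace G] [BorelSpace G]
    (μ : Measure G) [μ.IsHaarMeasure] (𝓗 : Set (HilbertSpace.{w, v} 𝕜)) :
    Set.BijOn
      (fun U : UnitaryReps G 𝓗 =>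
        (⟨U.1, U.2.crossedRep⟩ : (X : 𝓗) × (CrossedProduct μ 𝓗 →⋆ₙₐ[𝕜] (X.1 →L[𝕜] X.1))))
      Set.univ {T | IsNondegenerate T.2} ∧
    (∀ U : UnitaryReps G 𝓗,
      closedInvariantSubspaces (fun a : CrossedProduct μ 𝓗 => U.2.crossedRep a) =
        closedInvariantSubspaces (fun s : G => U.2 s)) ∧
    (∀ U V : UnitaryReps G 𝓗,
      intertwiners (fun a : CrossedProduct μ 𝓗 => U.2.crossedRep a)
          (fun a : CrossedProduct μ 𝓗 => V.2.crossedRep a) =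
        intertwiners (fun s : G => U.2 s) (fun s : G => V.2 s)) ∧
    (𝓗 = Set.univ → ∀ f : ConvAlg 𝕜 G μ,
      IsLUB (groupCStarNorms.{w, u, v} f) ‖CrossedProduct.q μ 𝓗 f‖) := by
  refine ⟨bijOn_crossedRep μ 𝓗, fun U => U.2.closedInvariantSubspaces_crossedRep μ,
    fun U V => U.2.intertwiners_crossedRep μ V.2, ?_⟩
  rintro rfl f
  exact isLUB_groupCStarNorms μ f

theorem theoremt {𝕜 : Type w} [RCLike 𝕜] {G : Type u} [Group G] [TopologicalSpace G]
    [IsTopologicalGroup G] [LocallyCompactSpace G] [T2Space G] [MeasurableSpace G] [BorelSpace G]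
    (μ : Measure G) [μ.IsHaarMeasure] (𝓗 : Set (HilbertSpace.{w, v} 𝕜)) (h𝓗 : 𝓗.Nonempty) :
    -- `U ↦ U^𝓡` is a bijection from `𝓡` onto the non-degenerate involutive representations of the
    -- crossed product in spaces from `𝓗`
    Set.BijOn
      (fun U : UnitaryReps G 𝓗 =>
        (⟨U.1, U.2.crossedRep⟩ : (X : 𝓗) × (CrossedProduct μ 𝓗 →⋆ₙₐ[𝕜] (X.1 →L[𝕜] X.1))))
      Set.univ {T | IsNondegenerate T.2} ∧
    -- it preserves the closed invariant subspaces
    (∀ U : UnitaryReps G 𝓗,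
      closedInvariantSubspaces (fun a : CrossedProduct μ 𝓗 => U.2.crossedRep a) =
        closedInvariantSubspaces (fun s : G => U.2 s)) ∧
    -- it preserves the space of bounded intertwining operators
    (∀ U V : UnitaryReps G 𝓗,
      intertwiners (fun a : CrossedProduct μ 𝓗 => U.2.crossedRep a)
          (fun a : CrossedProduct μ 𝓗 => V.2.crossedRep a) =
        intertwiners (fun s : G => U.2 s) (fun s : G => V.2 s)) ∧
    -- if `𝓗` consists of all Hilbert spaces, then the crossed product is `C⋆(G)`
    (𝓗 = Set.univ → ∀ f : ConvAlg 𝕜 G μ,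
      IsLUB (groupCStarNorms.{w, u, v} f) ‖CrossedProduct.q μ 𝓗 f‖) :=
  theoremt_general μ 𝓗
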